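/- Let $p$ be an odd prime, $\Gamma = 1+p\mathbb{Z}_p$, $\Gamma_n = 1+p^{n+1}\mathbb{Z}_p$ and $\Lambda = \mathbb{Z}_p[\![\Gamma]\!] = \varprojlim_n \mathbb{Z}_p[\Gamma/\Gamma_n]$. A continuous function $f:\Gamma\to\mathbb{Z}_p$ extends $\mathbb{Z}_p$-linearly and continuously to $\Lambda$, with $f(\alpha)=\lim_{n} \sum_{c\in\Gamma/\Gamma_n} \alpha_n(c) f(\tilde c)$ for $\alpha=(\alpha_n)_n \in\Lambda$, where $\tilde c\in\Gamma$ is any lift of $c$. For $s\in\mathbb{Z}_p$ let $\langle\,\rangle^s$ denote the function $x\mapsto x^s$ on $\Gamma$; a function $\varphi$ of $s$ is said to be given by an element $\alpha\in\Lambda$ if $\langle\,\rangle^s(\alpha)=\varphi(s)$ for all $s$ for which $\varphi(s)$ is defined. Let $X=\mathbb{Z}_p\times\mathbb{Z}/(p-1)\mathbb{Z}$, with the product topology, and view $\mathbb{Z}$ in $X$ through $k\mapsto (k,k)$. For $k=(s,u)\in X$ with $u$ even and $k\ne 0$, let $$\zeta^*(1-s,1-u)=\zeta^*(1-k)=\lim_{i\to\infty}\zeta(1-k_i)\in\mathbb{Q}_p,$$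 where $(k_i)$ is any sequence of even positive integers with $k_i\to\infty$ in the archimedean sense and $k_i\to k$ in $X$, and where $\zeta$ is the Riemann zeta function. Then all these limits exist (and do not depend on the choice of the sequence), and: 1. For every even $u\neq 0$ in $\mathbb{Z}/(p-1)\mathbb{Z}$, the function $\langle\,\rangle^s\mapsto\zeta^*(1-s,1-u)$ is given by an element of $\Lambda$: there is $\alpha\in\Lambda$ such that $\langle\,\rangle^s(\alpha)=\zeta^*(1-s,1-u)$ for all $s\in\mathbb{Z}_p$. 2. For $s\ne 0$ in $\mathbb{Z}_p$ one has $\zeta^*(1-s,1)\neq 0$, and the function $s\mapsto\zeta^*(1-s,1)^{-1}$ is given by an element $\alpha$ of $\Lambda$: $\langle\,\rangle^s(\alpha)=\zeta^*(1-s,1)^{-1}$ for all $s\neq 0$ in $\mathbb{Z}_p$. Moreover, under the isomorphism of $\mathbb{Z}_p$-algebras $\Lambda\cong\mathbb{Z}_p[\![T]\!]$ that sends $1+p\in\Gamma$ to $1+T$, the element $\alpha$ corresponds to a power series $T g(T)$ with $g(T)$ invertible in $\mathbb{Z}_p[\![T]\!]$. -/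

import Mathlib

open Filter Topology
open scoped PowerSeries

noncomputable section

/-- The value `ζ(1 - k)` for an integer `k ≥ 1`, as a rational number. -/
def zetaOneSub (k : ℕ) : ℚ := -bernoulli' k / k

theorem zetaOneSub_eq_riemannZeta (k : ℕ) (hk : 1 ≤ k) :
    ((zetaOneSub k : ℚ) : ℂ) = riemannZeta (1 - (k : ℂ)) := by
  obtain ⟨m, rfl⟩ := Nat.exists_eq_add_of_le' hk
  have h := riemannZeta_neg_nat_eq_bernoulli' m
  have h2 : (1 - ((m + 1 : ℕ) : ℂ)) = -(m : ℂ) := by push_cast; ring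
  rw [h2, h]
  simp [zetaOneSub]

variable (p : ℕ) [Fact p.Prime]

/-- The ring `X = ℤ_p × ℤ/(p-1)ℤ` of `p`-adic weights, with the product topology (the second
factor is discrete). An integer `k` is viewed in `X` through the ring homomorphism `ℤ → X`. -/
abbrev PadicWeight : Type := ℤ_[p] × ZMod (p - 1)

/-- The filter on `ℕ` along which an even positive integer `k` tends to infinity in the archimedean
sense and, at the same time, to the weight `κ` in `X`. -/
def weightFilter (κ : PadicWeight p) : Filter ℕ :=
  atTop ⊓ 𝓟 {k : ℕ | Even k} ⊓ comap (fun k : ℕ => (k : PadicWeight p)) (𝓝 κ)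

/-- `ζ*(1 - κ) = z`, in the sense that `ζ(1 - k)` converges to `z` in `ℚ_p` when the even integer
`k` tends to infinity and to `κ` in `X`. -/
def TendstoZetaStar (κ : PadicWeight p) (z : ℚ_[p]) : Prop :=
  Tendsto (fun k : ℕ => ((zetaOneSub k : ℚ) : ℚ_[p])) (weightFilter p κ) (𝓝 z)

/-- Serre's `p`-adic zeta function: `ζ*(x)` is the limit of `ζ(1 - k)` as `k → 1 - x`. -/
def zetaStar (x : PadicWeight p) : ℚ_[p] :=
  limUnder (weightFilter p (1 - x)) (fun k : ℕ => ((zetaOneSub k : ℚ) : ℚ_[p]))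

/-- The subgroup `1 + p ^ (n + 1) ℤ_p` of `ℤ_pˣ`. -/
def principalUnits (n : ℕ) : Subgroup ℤ_[p]ˣ :=
  (Units.map (PadicInt.toZModPow (p := p) (n + 1)).toMonoidHom).ker

theorem mem_principalUnits {n : ℕ} {x : ℤ_[p]ˣ} :
    x ∈ principalUnits p n ↔ (p : ℤ_[p]) ^ (n + 1) ∣ (x : ℤ_[p]) - 1 := by
  rw [← Ideal.mem_span_singleton, ← PadicInt.ker_toZModPow, RingHom.mem_ker, map_sub, map_one,
    sub_eq_zero, principalUnits, MonoidHom.mem_ker, Units.ext_iff]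
  rfl

theorem principalUnits_succ_le (n : ℕ) : principalUnits p (n + 1) ≤ principalUnits p n := by
  intro x hx
  rw [mem_principalUnits] at hx ⊢
  exact (pow_dvd_pow _ (Nat.le_succ _)).trans hx

/-- The group `Γ = 1 + p ℤ_p`. -/
abbrev GammaGroup : Type := principalUnits p 0

/-- The subgroup `Γ_n = 1 + p ^ (n + 1) ℤ_p = Γ ^ (p ^ n)` of `Γ`. -/
def gammaSub (n : ℕ) : Subgroup (GammaGroup p) :=
  (principalUnits p n).subgroupOf (principalUnits p 0)

/-- The projection `Γ / Γ_{n + 1} → Γ / Γ_n`. -/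
def gammaTransition (n : ℕ) : GammaGroup p ⧸ gammaSub p (n + 1) →* GammaGroup p ⧸ gammaSub p n :=
  QuotientGroup.map _ _ (MonoidHom.id _) fun _ hx => principalUnits_succ_le p n hx

/-- The Iwasawa algebra `Λ = ℤ_p[[Γ]]`, the inverse limit of the group rings `ℤ_p[Γ / Γ_n]`. -/
def iwasawaAlgebra : Subalgebra ℤ_[p] (∀ n, MonoidAlgebra ℤ_[p] (GammaGroup p ⧸ gammaSub p n)) where
  carrier := {x | ∀ n,
    MonoidAlgebra.mapDomainAlgHom ℤ_[p] ℤ_[p] (gammaTransition p n) (x (n + 1)) = x n}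
  mul_mem' := by
    intro a b ha hb n
    rw [Pi.mul_apply, map_mul, ha n, hb n]
    rfl
  add_mem' := by
    intro a b ha hb n
    rw [Pi.add_apply, map_add, ha n, hb n]
    rfl
  algebraMap_mem' := by
    intro r n
    simp only [Pi.algebraMap_apply]
    exact AlgHom.commutes _ r

/-- The Iwasawa algebra `Λ` as a type. -/
abbrev Lam : Type := iwasawaAlgebra p

variable {p}

/-- The inclusion `Γ → Λ`. -/
def groupLike (g : GammaGroup p) : Lam p :=
  ⟨fun n => MonoidAlgebra.of ℤ_[p] _ (QuotientGroup.mk g), fun n => by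
    simp only [MonoidAlgebra.of_apply, MonoidAlgebra.mapDomainAlgHom_apply,
      MonoidAlgebra.mapDomain_single]
    rfl⟩

/-- The extension to `Λ` of a continuous function `f : Γ → ℤ_p`, first `ℤ_p`-linearly to group
rings and then by continuity, takes the value `z` at `α`; equivalently, `z` is the integral of `f`
with respect to the measure on `Γ` that corresponds to `α`. -/
def HasValue (f : GammaGroup p → ℤ_[p]) (α : Lam p) (z : ℚ_[p]) : Prop :=
  Tendsto (fun n => (((α.1 n).coeff.sum fun c a => a * f c.out : ℤ_[p]) : ℚ_[p])) atTop (𝓝 z)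

theorem tendsto_pow_sub_one (x : GammaGroup p) :
    Tendsto ((((x : ℤ_[p]ˣ) : ℤ_[p]) - 1) ^ ·) atTop (𝓝 0) := by
  rw [tendsto_pow_atTop_nhds_zero_iff_norm_lt_one, PadicInt.norm_lt_one_iff_dvd]
  simpa using (mem_principalUnits p).1 x.2

/-- The character `⟨ ⟩ ^ s : Γ → Γ ⊂ ℤ_p`, `x ↦ x ^ s`, for `s ∈ ℤ_p`: for fixed `x`, the function
`s ↦ x ^ s` is the continuous character of `ℤ_p` that takes the value `x` at `1`. -/
def gammaPow (s : ℤ_[p]) (x : GammaGroup p) : ℤ_[p] :=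
  PadicInt.addChar_of_value_at_one (((x : ℤ_[p]ˣ) : ℤ_[p]) - 1) (tendsto_pow_sub_one x) s

variable (p)

theorem isUnit_one_add_p : IsUnit (1 + (p : ℤ_[p])) := by
  rw [PadicInt.isUnit_iff]
  have h : ‖(p : ℤ_[p])‖ < 1 := by
    simpa using (PadicInt.norm_lt_one_iff_dvd (p := p) (p : ℤ_[p])).2 dvd_rfl
  have h1 : ‖(1 : ℤ_[p])‖ ≠ ‖(p : ℤ_[p])‖ := by rw [norm_one]; exact h.ne'
  rw [IsUltrametricDist.norm_add_eq_max_of_norm_ne_norm h1, norm_one, max_eq_left h.le]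

/-- The topological generator `γ = 1 + p` of `Γ`. -/
def gammaGen : GammaGroup p :=
  ⟨(isUnit_one_add_p p).unit, by
    rw [mem_principalUnits]
    simp⟩

end

noncomputable section

namespace SerreZeta

variable {p : ℕ} [Fact p.Prime]

/-! ### Divisibility by powers of `p` in `ℤ_[p]` -/

/-! Since 1 + p generates Γ topologically, Λ is a power series ring in X, with 1 + X for 1 + p, and
integrating x ↦ x ^ s against an element of Λ evaluates its series at (1 + p) ^ s - 1 (`lamEquiv`,
`hasValue_lamEquiv`). The tool is Weierstrass division by (1 + X) ^ (p ^ n) - 1.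

For even k > 0, ζ(1 - k) = -B_k / k, and B_k is the p-adic limit of p ^ (-N) ∑ a ^ k over a < p ^ N.
If c is prime to p, permuting residues by a ↦ c a mod p ^ N and expanding to first order in p ^ N
gives (1 - c ^ k) B_k / k ≡ -∑ ⌊c a / p ^ N⌋ (c a) ^ (k - 1) modulo p ^ (N - 1), uniformly in k
(`norm_bernoulli_sub_floorSum_le`). Terms with p ∣ a are divisible by p ^ (k - 1). In the others (c
a) ^ k = ω(c a) ^ k ⟨c a⟩ ^ k is the value of an element of Λ once k modulo p - 1 is fixed. A limit
point as N grows is a series F whose value at k is within p ^ (-(k - 1)) of (1 - c ^ k) B_k / k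
(`exists_interpolation`). This error disappears as k → ∞, so ζ* = F / (W - 1), where W interpolates
c ^ k (`tendstoZetaStar_div`).

If u ≠ 0, taking c to be a primitive root modulo p makes W - 1 invertible. If u = 0, the choice c =
1 + p gives W - 1 = X, and p B_k ≡ -1 modulo p (von Staudt) makes F a unit, so that 1 / ζ* is given
by X F⁻¹. -/

theorem pow_dvd_iff_norm_le (x : ℤ_[p]) (n : ℕ) :
    (p : ℤ_[p]) ^ n ∣ x ↔ ‖x‖ ≤ (p : ℝ) ^ (-n : ℤ) := by
  rw [PadicInt.norm_le_pow_iff_mem_span_pow, Ideal.mem_span_singleton]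

theorem toZModPow_eq_iff (x y : ℤ_[p]) (n : ℕ) :
    PadicInt.toZModPow n x = PadicInt.toZModPow n y ↔ (p : ℤ_[p]) ^ n ∣ x - y := by
  rw [← Ideal.mem_span_singleton, ← PadicInt.ker_toZModPow, RingHom.mem_ker, map_sub, sub_eq_zero]

theorem isClosed_setOf_pow_dvd {Y : Type*} [TopologicalSpace Y] {f : Y → ℤ_[p]}
    (hf : Continuous f) (n : ℕ) : IsClosed {y | (p : ℤ_[p]) ^ n ∣ f y} := by
  simp only [pow_dvd_iff_norm_le]
  exact isClosed_le hf.norm continuous_const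

theorem eq_zero_of_forall_pow_dvd {x : ℤ_[p]} (h : ∀ n : ℕ, (p : ℤ_[p]) ^ n ∣ x) : x = 0 := by
  refine PadicInt.ext_of_toZModPow.1 fun n => ?_
  rw [toZModPow_eq_iff, sub_zero]
  exact h n

/-- In a neighbourhood of `s`, all elements are congruent to `s` modulo `p ^ n`. -/
theorem eventually_pow_dvd_sub (s : ℤ_[p]) (n : ℕ) : ∀ᶠ t in 𝓝 s, (p : ℤ_[p]) ^ n ∣ t - s := by
  have hp : (0 : ℝ) < p := by exact_mod_cast (Fact.out : p.Prime).pos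
  filter_upwards [Metric.closedBall_mem_nhds s (zpow_pos hp (-n : ℤ))] with t ht
  rwa [pow_dvd_iff_norm_le, ← dist_eq_norm]

theorem tendsto_of_forall_pow_dvd_sub {ι : Type*} {l : Filter ι} {f : ι → ℤ_[p]} {a : ℤ_[p]}
    (h : ∀ n : ℕ, ∀ᶠ i in l, (p : ℤ_[p]) ^ n ∣ f i - a) : Tendsto f l (𝓝 a) := by
  rw [Metric.tendsto_nhds]
  intro ε hε
  obtain ⟨n, hn⟩ := PadicInt.exists_pow_neg_lt p hε
  filter_upwards [h n] with i hi
  rw [dist_eq_norm]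
  exact ((pow_dvd_iff_norm_le _ _).1 hi).trans_lt hn

/-- If w is the p-adic valuation of j, then w + 2 ≤ 3 ^ w ≤ j when w > 0. For p = 2 this already
fails at j = 2. -/
theorem natCast_dvd_pow_sub_two (hp : p ≠ 2) {j : ℕ} (hj : 2 ≤ j) :
    (j : ℤ_[p]) ∣ (p : ℤ_[p]) ^ (j - 2) := by
  have hpp : p.Prime := Fact.out
  have hp3 : 3 ≤ p := lt_of_le_of_ne hpp.two_le (Ne.symm hp)
  obtain ⟨w, m, hm, hjm⟩ := Nat.exists_eq_pow_mul_and_not_dvd (show j ≠ 0 by omega) p hpp.ne_one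
  have hw : w ≤ j - 2 := by
    rcases Nat.eq_zero_or_pos w with rfl | hw
    · exact Nat.zero_le _
    have h1 : w + 2 ≤ 3 ^ w := by
      clear hjm
      induction w, hw using Nat.le_induction with
      | base => norm_num
      | succ w _ ih => rw [pow_succ]; omega
    have h2 : 3 ^ w ≤ p ^ w := Nat.pow_le_pow_left hp3 w
    have h3 : p ^ w ≤ j := Nat.le_of_dvd (by omega) (Dvd.intro _ hjm.symm)
    omega
  have hu : IsUnit (m : ℤ_[p]) := by
    rw [PadicInt.isUnit_iff, PadicInt.norm_natCast_eq_one_iff]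
    exact (Nat.Prime.coprime_iff_not_dvd hpp).2 hm
  rw [hjm]
  push_cast
  exact (hu.mul_right_dvd).2 (pow_dvd_pow _ (by rw [← hjm]; exact hw))

/-- The expansion of `(x + p ^ N y) ^ k` to first order, with an error term divisible by `k`. -/
theorem mul_dvd_add_pow_sub (hp : p ≠ 2) {N : ℕ} (hN : 1 ≤ N) (x y : ℤ_[p]) (k : ℕ) :
    (k : ℤ_[p]) * (p : ℤ_[p]) ^ (2 * N) ∣
      (x + (p : ℤ_[p]) ^ N * y) ^ k - x ^ k - k * (p : ℤ_[p]) ^ N * x ^ (k - 1) * y := by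
  rcases k with _ | k
  · simp
  rw [add_comm x, add_pow, Finset.sum_range_succ', Finset.sum_range_succ']
  simp only [zero_add, pow_zero, one_mul, pow_one, Nat.choose_zero_right, Nat.choose_one_right,
    Nat.cast_one, mul_one, Nat.sub_zero, Nat.add_sub_cancel]
  have h : ∀ A B C : ℤ_[p], A + (p : ℤ_[p]) ^ N * y * B * C + x ^ (k + 1) - x ^ (k + 1) -
      C * (p : ℤ_[p]) ^ N * B * y = A := by intros; ring
  rw [h]
  refine Finset.dvd_sum fun i _ => ?_
  obtain ⟨d, hd⟩ := (natCast_dvd_pow_sub_two hp (show 2 ≤ i + 1 + 1 by omega)).trans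
    (pow_dvd_pow (p : ℤ_[p]) (show i + 1 + 1 - 2 ≤ N * i by
      simpa using Nat.le_mul_of_pos_left i hN))
  -- The binomial coefficient is (k + 1) / (i + 2) times an integer. The denominator i + 2 is
  -- absorbed by p ^ (N i), and the factor k + 1 survives in the error term.
  have hc : (((k + 1).choose (i + 1 + 1) : ℕ) : ℤ_[p]) * ((i + 1 + 1 : ℕ) : ℤ_[p]) =
      ((k + 1 : ℕ) : ℤ_[p]) * ((k.choose (i + 1) : ℕ) : ℤ_[p]) := by
    exact_mod_cast (Nat.add_one_mul_choose_eq k (i + 1)).symm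
  refine ⟨y ^ (i + 1 + 1) * x ^ (k + 1 - (i + 1 + 1)) * d * (k.choose (i + 1) : ℕ), ?_⟩
  have he : ((p : ℤ_[p]) ^ N) ^ (i + 1 + 1) = (p : ℤ_[p]) ^ (2 * N) * (p : ℤ_[p]) ^ (N * i) := by
    rw [← pow_mul, ← pow_add]; congr 1; ring
  rw [mul_pow, he, hd]
  linear_combination (p : ℤ_[p]) ^ (2 * N) * d * y ^ (i + 1 + 1) * x ^ (k + 1 - (i + 1 + 1)) * hc

/-! ### The characters `x ↦ x ^ s` of `Γ` -/

theorem dvd_coe_sub_one (x : GammaGroup p) : (p : ℤ_[p]) ∣ ((x : ℤ_[p]ˣ) : ℤ_[p]) - 1 := by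
  simpa using (mem_principalUnits p).1 x.2

theorem continuous_gammaPow (x : GammaGroup p) : Continuous fun s => gammaPow s x :=
  PadicInt.continuous_addChar_of_value_at_one _

theorem gammaPow_one (x : GammaGroup p) : gammaPow 1 x = ((x : ℤ_[p]ˣ) : ℤ_[p]) := by
  rw [gammaPow, PadicInt.addChar_of_value_at_one_def]; ring

theorem gammaPow_nsmul (n : ℕ) (s : ℤ_[p]) (x : GammaGroup p) :
    gammaPow (n • s) x = gammaPow s x ^ n := AddChar.map_nsmul_eq_pow _ _ _

theorem gammaPow_zero (x : GammaGroup p) : gammaPow 0 x = 1 := AddChar.map_zero_eq_one _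

theorem gammaPow_natCast (k : ℕ) (x : GammaGroup p) :
    gammaPow (k : ℤ_[p]) x = ((x : ℤ_[p]ˣ) : ℤ_[p]) ^ k := by
  rw [← gammaPow_one, ← gammaPow_nsmul, nsmul_one]

/-- Both sides are continuous in s and ℕ is dense in ℤ_p, so natural exponents suffice. The same
argument gives the congruence and the value at 1 below. -/
theorem gammaPow_mul (s : ℤ_[p]) (x y : GammaGroup p) :
    gammaPow s (x * y) = gammaPow s x * gammaPow s y := by
  induction s using PadicInt.denseRange_natCast.induction_on with
  | hp =>
    exact isClosed_eq (continuous_gammaPow _) ((continuous_gammaPow _).mul (continuous_gammaPow _))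
  | ih k => simp [gammaPow_natCast, mul_pow]

theorem pow_dvd_gammaPow_sub (s : ℤ_[p]) {x y : GammaGroup p} {n : ℕ}
    (h : (p : ℤ_[p]) ^ n ∣ ((x : ℤ_[p]ˣ) : ℤ_[p]) - ((y : ℤ_[p]ˣ) : ℤ_[p])) :
    (p : ℤ_[p]) ^ n ∣ gammaPow s x - gammaPow s y := by
  induction s using PadicInt.denseRange_natCast.induction_on with
  | hp => exact isClosed_setOf_pow_dvd ((continuous_gammaPow _).sub (continuous_gammaPow _)) n
  | ih k =>
    simp only [gammaPow_natCast]
    exact h.trans (sub_dvd_pow_sub_pow _ _ _)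

theorem gammaPow_one_right (s : ℤ_[p]) : gammaPow s (1 : GammaGroup p) = 1 := by
  induction s using PadicInt.denseRange_natCast.induction_on with
  | hp => exact isClosed_eq (continuous_gammaPow _) continuous_const
  | ih k => simp [gammaPow_natCast]

theorem dvd_gammaPow_sub_one (s : ℤ_[p]) (x : GammaGroup p) : (p : ℤ_[p]) ∣ gammaPow s x - 1 := by
  have h := pow_dvd_gammaPow_sub (n := 1) s (x := x) (y := 1) (by simpa using dvd_coe_sub_one x)
  rwa [pow_one, gammaPow_one_right] at h

theorem isUnit_of_dvd_sub_one {x : ℤ_[p]} (h : (p : ℤ_[p]) ∣ x - 1) : IsUnit x := by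
  have h1 : x - 1 ∈ IsLocalRing.maximalIdeal ℤ_[p] := by
    rwa [PadicInt.maximalIdeal_eq_span_p, Ideal.mem_span_singleton]
  by_contra hx
  exact (IsLocalRing.maximalIdeal.isMaximal ℤ_[p]).ne_top ((Ideal.eq_top_iff_one _).2
    (by simpa using sub_mem ((IsLocalRing.mem_maximalIdeal x).2 hx) h1))

/-- Every unit of `ℤ_[p]` is the product of a root of unity of order dividing `p - 1` and an
element of `Γ`. -/
theorem exists_eq_rootOfUnity_mul (b : ℤ_[p]ˣ) :
    ∃ w : ℤ_[p]ˣ × GammaGroup p, w.1 ^ (p - 1) = 1 ∧ b = w.1 * w.2 := by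
  have hpp : p.Prime := Fact.out
  have hb : b ^ (p - 1) ∈ principalUnits p 0 := by
    rw [principalUnits, MonoidHom.mem_ker, map_pow]
    have h := ZMod.pow_totient (Units.map (PadicInt.toZModPow (p := p) (0 + 1)).toMonoidHom b)
    rwa [show (p ^ (0 + 1)).totient = p - 1 by simp [Nat.totient_prime hpp]] at h
  obtain ⟨t, ht⟩ : IsUnit ((p - 1 : ℕ) : ℤ_[p]) := by
    rw [PadicInt.isUnit_iff, PadicInt.norm_natCast_eq_one_iff]
    exact (Nat.coprime_self_sub_right hpp.one_le).2 (Nat.coprime_one_right p)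
  set y : GammaGroup p := ⟨b ^ (p - 1), hb⟩ with hy
  -- As p - 1 is a unit t, the element b ^ (p - 1) of Γ has the (p - 1)-th root (b ^ (p - 1)) ^
  -- (t⁻¹) in Γ. Dividing b by it leaves a root of unity.
  have hdvd := dvd_gammaPow_sub_one ((t⁻¹ : ℤ_[p]ˣ) : ℤ_[p]) y
  obtain ⟨g, hg⟩ := isUnit_of_dvd_sub_one hdvd
  have hgp : g ^ (p - 1) = b ^ (p - 1) := by
    ext
    rw [Units.val_pow_eq_pow_val, hg, ← gammaPow_nsmul, nsmul_eq_mul, ← ht, Units.mul_inv,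
      gammaPow_one]
  have hgΓ : g ∈ principalUnits p 0 := by
    rw [mem_principalUnits, hg]
    simpa using hdvd
  refine ⟨(b * g⁻¹, ⟨g, hgΓ⟩), ?_, by simp⟩
  simp [mul_pow, hgp]

/-- The root of unity `ω(b)` attached to a unit `b` of `ℤ_[p]`. -/
def omegaPart (b : ℤ_[p]ˣ) : ℤ_[p]ˣ := (exists_eq_rootOfUnity_mul b).choose.1

/-- The component `⟨b⟩` in `Γ` of a unit `b` of `ℤ_[p]`. -/
def gammaPart (b : ℤ_[p]ˣ) : GammaGroup p := (exists_eq_rootOfUnity_mul b).choose.2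

theorem omegaPart_pow (b : ℤ_[p]ˣ) : omegaPart b ^ (p - 1) = 1 :=
  (exists_eq_rootOfUnity_mul b).choose_spec.1

theorem omegaPart_mul_gammaPart (b : ℤ_[p]ˣ) : b = omegaPart b * (gammaPart b : ℤ_[p]ˣ) :=
  (exists_eq_rootOfUnity_mul b).choose_spec.2

/-- `x ↦ x ^ s` modulo `p ^ (n + 1)`, as a character of `Γ / Γ_n`. -/
def gammaPowMod (s : ℤ_[p]) (n : ℕ) : GammaGroup p ⧸ gammaSub p n →* ZMod (p ^ (n + 1)) :=
  QuotientGroup.lift (gammaSub p n)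
    { toFun := fun x => PadicInt.toZModPow (n + 1) (gammaPow s x)
      map_one' := by rw [gammaPow_one_right, map_one]
      map_mul' := fun x y => by rw [gammaPow_mul, map_mul] } (by
    intro x hx
    rw [MonoidHom.mem_ker]
    change PadicInt.toZModPow (n + 1) (gammaPow s x) = 1
    rw [← map_one (PadicInt.toZModPow (n + 1)), toZModPow_eq_iff, ← gammaPow_one_right s]
    refine pow_dvd_gammaPow_sub s ?_
    simpa using (mem_principalUnits p).1 (Subgroup.mem_subgroupOf.1 hx))

theorem gammaPowMod_mk (s : ℤ_[p]) (n : ℕ) (x : GammaGroup p) :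
    gammaPowMod s n (QuotientGroup.mk x) = PadicInt.toZModPow (n + 1) (gammaPow s x) := rfl

/-! ### The polynomials `(1 + X) ^ (p ^ n) - 1` and division by them -/

variable (p) in
/-- The polynomial `(1 + X) ^ (p ^ n) - 1`. -/
def omegaPoly (n : ℕ) : Polynomial ℤ_[p] := (1 + Polynomial.X) ^ p ^ n - 1

theorem omegaPoly_coeff_zero (n : ℕ) : (omegaPoly p n).coeff 0 = 0 := by
  simp [omegaPoly, Polynomial.coeff_zero_eq_eval_zero]

theorem omegaPoly_coeff (n : ℕ) {j : ℕ} (hj : j ≠ 0) :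
    (omegaPoly p n).coeff j = ((p ^ n).choose j : ℕ) := by
  rw [omegaPoly, Polynomial.coeff_sub, Polynomial.coeff_one_add_X_pow, Polynomial.coeff_one,
    if_neg hj, sub_zero]

theorem natDegree_omegaPoly (n : ℕ) : (omegaPoly p n).natDegree = p ^ n := by
  have hpos : 0 < p ^ n := pow_pos (Fact.out : p.Prime).pos n
  refine Polynomial.natDegree_eq_of_le_of_coeff_ne_zero ?_ ?_
  · refine (Polynomial.natDegree_sub_le _ _).trans (max_le ?_ (by simp))
    refine Polynomial.natDegree_pow_le.trans ?_
    have : (1 + Polynomial.X : Polynomial ℤ_[p]).natDegree ≤ 1 := by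
      rw [add_comm]; exact (Polynomial.natDegree_X_add_C (1 : ℤ_[p])).le
    simpa using Nat.mul_le_mul_left (p ^ n) this
  · rw [omegaPoly_coeff n hpos.ne']
    simp

theorem monic_omegaPoly (n : ℕ) : (omegaPoly p n).Monic := by
  rw [Polynomial.Monic, Polynomial.leadingCoeff, natDegree_omegaPoly,
    omegaPoly_coeff n (pow_pos (Fact.out : p.Prime).pos n).ne']
  simp

theorem isDistinguishedAt_omegaPoly (n : ℕ) :
    (omegaPoly p n).IsDistinguishedAt (IsLocalRing.maximalIdeal ℤ_[p]) where
  monic := monic_omegaPoly n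
  mem {j} hj := by
    rw [natDegree_omegaPoly] at hj
    rw [PadicInt.maximalIdeal_eq_span_p, Ideal.mem_span_singleton]
    rcases eq_or_ne j 0 with rfl | h0
    · rw [omegaPoly_coeff_zero]; exact dvd_zero _
    · rw [omegaPoly_coeff n h0]
      exact_mod_cast Nat.cast_dvd_cast ((Fact.out : p.Prime).dvd_choose_pow h0 hj.ne)

theorem exists_eq_omegaPoly_mul_add (n : ℕ) (f : ℤ_[p]⟦X⟧) :
    ∃ (q : ℤ_[p]⟦X⟧) (r : Polynomial ℤ_[p]), f = (omegaPoly p n : ℤ_[p]⟦X⟧) * q + r := by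
  have H := (isDistinguishedAt_omegaPoly (p := p) n).isWeierstrassDivisorAt'
  exact ⟨_, _, (H.isWeierstrassDivisionAt_div_mod f).2⟩

/-- Weierstrass division reduces the comparison to polynomials, so no continuity of the
homomorphisms is needed. -/
theorem ringHom_ext_of_omegaPoly {S : Type*} [Semiring S] (n : ℕ) {f g : ℤ_[p]⟦X⟧ →+* S}
    (hC : ∀ a, f (PowerSeries.C a) = g (PowerSeries.C a)) (hX : f PowerSeries.X = g PowerSeries.X)
    (hf : f (omegaPoly p n : ℤ_[p]⟦X⟧) = 0) : f = g := by
  have hpoly : ∀ r : Polynomial ℤ_[p], f (r : ℤ_[p]⟦X⟧) = g (r : ℤ_[p]⟦X⟧) := by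
    have : f.comp Polynomial.coeToPowerSeries.ringHom =
        g.comp Polynomial.coeToPowerSeries.ringHom :=
      Polynomial.ringHom_ext (by simpa using hC) (by simpa using hX)
    exact fun r => by simpa using congr($this r)
  ext x
  obtain ⟨q, r, rfl⟩ := exists_eq_omegaPoly_mul_add n x
  rw [map_add, map_add, map_mul, map_mul, ← hpoly, hf, zero_mul, zero_mul, hpoly]

/-- Since p ^ n divides j * (p ^ n choose j), the product of i! with any coefficient of index at
most i of the n-th polynomial is divisible by p ^ n. Hence i! times the i-th coefficient of f is
divisible by every power of p. -/
theorem eq_zero_of_forall_omegaPoly_dvd {f : ℤ_[p]⟦X⟧}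
    (h : ∀ n, (omegaPoly p n : ℤ_[p]⟦X⟧) ∣ f) : f = 0 := by
  ext i
  rw [map_zero]
  have key : ((i.factorial : ℕ) : ℤ_[p]) * PowerSeries.coeff i f = 0 := by
    refine eq_zero_of_forall_pow_dvd fun n => ?_
    obtain ⟨q, rfl⟩ := h n
    rw [PowerSeries.coeff_mul, Finset.mul_sum]
    refine Finset.dvd_sum fun x hx => ?_
    rw [← mul_assoc]
    refine Dvd.dvd.mul_right ?_ _
    rw [Polynomial.coeff_coe]
    rcases eq_or_ne x.1 0 with h0 | h0
    · rw [h0, omegaPoly_coeff_zero, mul_zero]; exact dvd_zero _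
    · rw [omegaPoly_coeff n h0]
      have h1 : x.1 ∣ i.factorial := Nat.dvd_factorial (Nat.pos_of_ne_zero h0)
        (Finset.HasAntidiagonal.antidiagonal.fst_le hx)
      have h2 : p ^ n ∣ x.1 * (p ^ n).choose x.1 := by
        obtain ⟨j, hj⟩ := Nat.exists_eq_succ_of_ne_zero h0
        obtain ⟨m, hm⟩ := Nat.exists_eq_succ_of_ne_zero (pow_pos (Fact.out : p.Prime).pos n).ne'
        rw [hm, hj, Nat.succ_eq_add_one, Nat.succ_eq_add_one, mul_comm, ← Nat.add_one_mul_choose_eq]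
        exact dvd_mul_right _ _
      exact_mod_cast Nat.cast_dvd_cast (α := ℤ_[p]) (h2.trans (Nat.mul_dvd_mul_right h1 _))
  exact (mul_eq_zero.1 key).resolve_left (by exact_mod_cast i.factorial_ne_zero)

/-! ### The cyclic groups `Γ / Γ_n` -/

theorem mk_eq_mk_iff {n : ℕ} {x y : GammaGroup p} :
    (QuotientGroup.mk x : GammaGroup p ⧸ gammaSub p n) = QuotientGroup.mk y ↔
      (p : ℤ_[p]) ^ (n + 1) ∣ ((y : ℤ_[p]ˣ) : ℤ_[p]) - ((x : ℤ_[p]ˣ) : ℤ_[p]) := by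
  rw [QuotientGroup.eq, gammaSub, Subgroup.mem_subgroupOf, mem_principalUnits]
  have h : ((y : ℤ_[p]ˣ) : ℤ_[p]) - ((x : ℤ_[p]ˣ) : ℤ_[p]) =
      ((x : ℤ_[p]ˣ) : ℤ_[p]) * (((x⁻¹ * y : GammaGroup p) : ℤ_[p]ˣ) - 1) := by
    simp [mul_sub]
  rw [h, (Units.isUnit _).dvd_mul_left]

variable (p) in
/-- The image of the generator `1 + p` in `Γ / Γ_n`. -/
def genMod (n : ℕ) : GammaGroup p ⧸ gammaSub p n := QuotientGroup.mk (gammaGen p)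

theorem coe_gammaGen : ((gammaGen p : ℤ_[p]ˣ) : ℤ_[p]) = 1 + p := rfl

/-- `(1 + p) ^ k - 1` is `k p` up to a unit congruent to `1` modulo `p`. -/
theorem exists_one_add_pow_sub_one (hp : p ≠ 2) (k : ℕ) :
    ∃ z : ℤ_[p], (1 + (p : ℤ_[p])) ^ k - 1 = k * p * (1 + p * z) := by
  obtain ⟨z, hz⟩ := mul_dvd_add_pow_sub hp le_rfl (1 : ℤ_[p]) 1 k
  refine ⟨z, ?_⟩
  simp only [mul_one, pow_one, one_pow] at hz
  linear_combination hz

theorem isUnit_one_add_mul (z : ℤ_[p]) : IsUnit (1 + (p : ℤ_[p]) * z) :=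
  isUnit_of_dvd_sub_one (by simp)

theorem pow_dvd_one_add_pow_sub_one_iff (hp : p ≠ 2) (n k : ℕ) :
    (p : ℤ_[p]) ^ (n + 1) ∣ (1 + (p : ℤ_[p])) ^ k - 1 ↔ p ^ n ∣ k := by
  obtain ⟨z, hz⟩ := exists_one_add_pow_sub_one hp k
  have hp0 : (p : ℤ_[p]) ≠ 0 := by exact_mod_cast (Fact.out : p.Prime).ne_zero
  rw [hz, (isUnit_one_add_mul z).dvd_mul_right, pow_succ, mul_dvd_mul_iff_right hp0]
  rw [← sub_zero (k : ℤ_[p]), ← toZModPow_eq_iff, map_natCast, map_zero, ZMod.natCast_eq_zero_iff]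

theorem genMod_pow_eq_one_iff (hp : p ≠ 2) (n k : ℕ) : genMod p n ^ k = 1 ↔ p ^ n ∣ k := by
  rw [← pow_dvd_one_add_pow_sub_one_iff hp, eq_comm]
  exact mk_eq_mk_iff (x := 1) (y := gammaGen p ^ k)

theorem genMod_pow_eq_one (hp : p ≠ 2) (n : ℕ) : genMod p n ^ p ^ n = 1 :=
  (genMod_pow_eq_one_iff hp n _).2 dvd_rfl

theorem orderOf_genMod (hp : p ≠ 2) (n : ℕ) : orderOf (genMod p n) = p ^ n :=
  Nat.dvd_antisymm (orderOf_dvd_of_pow_eq_one (genMod_pow_eq_one hp n))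
    ((genMod_pow_eq_one_iff hp n _).1 (pow_orderOf_eq_one _))

theorem genMod_pow_bijective (hp : p ≠ 2) (n : ℕ) :
    Function.Bijective fun j : Fin (p ^ n) => genMod p n ^ (j : ℕ) := by
  have hp0 : (p : ℤ_[p]) ≠ 0 := by exact_mod_cast (Fact.out : p.Prime).ne_zero
  have : NeZero (p ^ n) := ⟨(pow_pos (Fact.out : p.Prime).pos n).ne'⟩
  choose d hd using fun x : GammaGroup p => dvd_coe_sub_one x
  -- Surjectivity comes from counting: x ↦ (x - 1) / p modulo p ^ n embeds Γ / Γ_n in a set of p ^ n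
  -- elements.
  have hinj : Function.Injective fun c : GammaGroup p ⧸ gammaSub p n =>
      PadicInt.toZModPow n (d c.out) := by
    intro c c' h
    rw [← c.out_eq', ← c'.out_eq']
    refine mk_eq_mk_iff.2 ?_
    have h' := (toZModPow_eq_iff _ _ _).1 (Eq.symm h)
    have e : ((c'.out : ℤ_[p]ˣ) : ℤ_[p]) - ((c.out : ℤ_[p]ˣ) : ℤ_[p]) =
        (d c'.out - d c.out) * p := by
      linear_combination hd c'.out - hd c.out
    rw [e, pow_succ]
    exact mul_dvd_mul_right h' _
  have hfin : Finite (GammaGroup p ⧸ gammaSub p n) := Finite.of_injective _ hinj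
  refine Function.Injective.bijective_of_nat_card_le ?_ ?_
  · intro i j h
    exact Fin.ext (pow_injOn_Iio_orderOf (by rw [orderOf_genMod hp]; exact i.2)
      (by rw [orderOf_genMod hp]; exact j.2) h)
  · simpa using Nat.card_le_card_of_injective _ hinj

/-! ### Maps from power series to group rings -/

section GroupRing

variable {G : Type*} [Group G] {g : G} {n : ℕ}

theorem aeval_omegaPoly (hg : g ^ p ^ n = 1) :
    Polynomial.aeval (MonoidAlgebra.of ℤ_[p] G g - 1) (omegaPoly p n) = 0 := by
  simp only [omegaPoly, map_sub, map_pow, map_add, map_one, Polynomial.aeval_X, add_sub_cancel]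
  rw [← map_pow, hg, map_one, sub_self]

/-- The homomorphism `ℤ_p⟦X⟧ → ℤ_p[G]` that sends `1 + X` to an element `g` with
`g ^ (p ^ n) = 1`. -/
def toGroupRing (hg : g ^ p ^ n = 1) : ℤ_[p]⟦X⟧ →ₐ[ℤ_[p]] MonoidAlgebra ℤ_[p] G :=
  ((Ideal.Quotient.liftₐ (Ideal.span {omegaPoly p n})
    (Polynomial.aeval (MonoidAlgebra.of ℤ_[p] _ g - 1)) (by
      intro a ha
      obtain ⟨b, rfl⟩ := Ideal.mem_span_singleton.1 ha
      rw [map_mul, aeval_omegaPoly hg, zero_mul])).comp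
    (isDistinguishedAt_omegaPoly n).algEquivQuotient.symm.toAlgHom).comp
    (Ideal.Quotient.mkₐ ℤ_[p] (Ideal.span {(omegaPoly p n : ℤ_[p]⟦X⟧)}))

theorem toGroupRing_coe (hg : g ^ p ^ n = 1) (r : Polynomial ℤ_[p]) :
    toGroupRing hg (r : ℤ_[p]⟦X⟧) = Polynomial.aeval (MonoidAlgebra.of ℤ_[p] _ g - 1) r := by
  have h : (isDistinguishedAt_omegaPoly (p := p) n).algEquivQuotient.symm
      (Ideal.Quotient.mk _ (r : ℤ_[p]⟦X⟧)) = Ideal.Quotient.mk _ r := by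
    rw [AlgEquiv.symm_apply_eq, Polynomial.IsDistinguishedAt.algEquivQuotient_apply]
    simp
  simp only [toGroupRing, AlgHom.comp_apply, Ideal.Quotient.mkₐ_eq_mk]
  erw [h]
  rfl

theorem toGroupRing_X (hg : g ^ p ^ n = 1) :
    toGroupRing hg PowerSeries.X = MonoidAlgebra.of ℤ_[p] _ g - 1 := by
  rw [← Polynomial.coe_X, toGroupRing_coe, Polynomial.aeval_X]

theorem toGroupRing_one_add_X (hg : g ^ p ^ n = 1) :
    toGroupRing hg (1 + PowerSeries.X) = MonoidAlgebra.of ℤ_[p] _ g := by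
  rw [map_add, map_one, toGroupRing_X, add_sub_cancel]

theorem toGroupRing_C (hg : g ^ p ^ n = 1) (a : ℤ_[p]) :
    toGroupRing hg (PowerSeries.C a) = algebraMap ℤ_[p] _ a := by
  rw [← Polynomial.coe_C, toGroupRing_coe, Polynomial.aeval_C]

theorem toGroupRing_omegaPoly (hg : g ^ p ^ n = 1) :
    toGroupRing hg (omegaPoly p n : ℤ_[p]⟦X⟧) = 0 := by
  rw [toGroupRing_coe, aeval_omegaPoly hg]

theorem toGroupRing_surjective (hg : g ^ p ^ n = 1)
    (hG : Function.Surjective fun j : Fin (p ^ n) => g ^ (j : ℕ)) :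
    Function.Surjective (toGroupRing hg) := by
  intro x
  change x ∈ (toGroupRing hg).range
  induction x using MonoidAlgebra.induction_linear with
  | zero => exact zero_mem _
  | add f g hf hg => exact add_mem hf hg
  | single c a =>
    obtain ⟨j, rfl⟩ := hG c
    refine ⟨PowerSeries.C a * (1 + PowerSeries.X) ^ (j : ℕ), ?_⟩
    change toGroupRing hg _ = _
    rw [map_mul, map_pow, toGroupRing_one_add_X, toGroupRing_C, ← map_pow]
    simp [MonoidAlgebra.single_mul_single]

/-- Modulo the divisor, f is a polynomial of degree less than p ^ n. Written in powers of 1 + X, it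
maps to a combination of distinct group elements with the same coefficients. -/
theorem omegaPoly_dvd_of_toGroupRing_eq_zero (hg : g ^ p ^ n = 1)
    (hG : Function.Injective fun j : Fin (p ^ n) => g ^ (j : ℕ)) {f : ℤ_[p]⟦X⟧}
    (h : toGroupRing hg f = 0) : (omegaPoly p n : ℤ_[p]⟦X⟧) ∣ f := by
  obtain ⟨q, r, rfl⟩ := exists_eq_omegaPoly_mul_add n f
  rw [map_add, map_mul, toGroupRing_omegaPoly, zero_mul, zero_add] at h
  rw [← r.modByMonic_add_div (omegaPoly p n)] at h ⊢
  set r' := r %ₘ omegaPoly p n with hr'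
  have hdeg : r'.natDegree < p ^ n := by
    rw [← natDegree_omegaPoly]
    refine Polynomial.natDegree_modByMonic_lt _ (monic_omegaPoly n) fun h1 => ?_
    have := natDegree_omegaPoly (p := p) n
    rw [h1, Polynomial.natDegree_one] at this
    exact (pow_pos (Fact.out : p.Prime).pos n).ne this
  rw [Polynomial.coe_add, Polynomial.coe_mul, map_add, map_mul, toGroupRing_omegaPoly, zero_mul,
    add_zero] at h
  -- Composition with X - 1 turns the expansion in powers of 1 + X into the ordinary one.
  have hr0 : r'.comp (Polynomial.X - 1) = 0 := by
    set R := r'.comp (Polynomial.X - 1) with hR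
    have hRd : R.natDegree < p ^ n := by
      rw [hR, Polynomial.natDegree_comp, ← Polynomial.C_1, Polynomial.natDegree_X_sub_C, mul_one]
      exact hdeg
    have hsum : Polynomial.aeval (MonoidAlgebra.of ℤ_[p] _ g) R = 0 := by
      rw [hR, Polynomial.aeval_comp, map_sub, Polynomial.aeval_X, map_one, ← toGroupRing_coe hg]
      exact h
    rw [Polynomial.aeval_eq_sum_range' hRd] at hsum
    ext j
    rw [Polynomial.coeff_zero]
    rcases lt_or_ge j (p ^ n) with hj | hj
    · have hc := congr(MonoidAlgebra.coeff $hsum (g ^ j))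
      rw [MonoidAlgebra.coeff_sum, Finsupp.finsetSum_apply, Finset.sum_eq_single j] at hc
      · simpa [MonoidAlgebra.single_pow] using hc
      · intro i hi hij
        have hne : g ^ i ≠ g ^ j := fun hh => hij <| by
          simpa using hG (a₁ := ⟨i, Finset.mem_range.1 hi⟩) (a₂ := ⟨j, hj⟩) hh
        simp [MonoidAlgebra.single_pow, hne]
      · intro hj'
        exact absurd (Finset.mem_range.2 hj) hj'
    · exact Polynomial.coeff_eq_zero_of_natDegree_lt (hRd.trans_le hj)
  have hr'0 : r' = 0 := by
    have := congr(Polynomial.comp $hr0 (Polynomial.X + 1))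
    simpa [Polynomial.comp_assoc] using this
  rw [hr'0, zero_add, Polynomial.coe_mul]
  exact dvd_add (dvd_mul_right _ _) (dvd_mul_right _ _)

theorem ringHom_comp_toGroupRing {S : Type*} [Ring S] (hg : g ^ p ^ n = 1)
    (φ : MonoidAlgebra ℤ_[p] G →+* S) {ψ : ℤ_[p]⟦X⟧ →+* S}
    (hC : ∀ a, φ (algebraMap ℤ_[p] _ a) = ψ (PowerSeries.C a))
    (hX : φ (MonoidAlgebra.of ℤ_[p] _ g) = ψ (1 + PowerSeries.X)) (f : ℤ_[p]⟦X⟧) :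
    φ (toGroupRing hg f) = ψ f := by
  have h := ringHom_ext_of_omegaPoly n (f := φ.comp (toGroupRing hg).toRingHom) (g := ψ)
    (fun a => by
      rw [← hC, ← toGroupRing_C hg]; rfl)
    (by
      rw [map_add, map_one, ← toGroupRing_one_add_X hg, map_add, map_add, map_one, map_one,
        add_right_inj] at hX
      exact hX)
    (by
      change φ (toGroupRing hg _) = 0
      rw [toGroupRing_omegaPoly, map_zero])
  exact congr($h f)

theorem mapDomain_toGroupRing {H : Type*} [Group H] {h : H} {m : ℕ} (φ : G →* H)
    (hg : g ^ p ^ n = 1) (hh : h ^ p ^ m = 1) (hφ : φ g = h) (f : ℤ_[p]⟦X⟧) :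
    MonoidAlgebra.mapDomainAlgHom ℤ_[p] ℤ_[p] φ (toGroupRing hg f) = toGroupRing hh f := by
  refine ringHom_comp_toGroupRing hg (MonoidAlgebra.mapDomainAlgHom ℤ_[p] ℤ_[p] φ).toRingHom
    (ψ := (toGroupRing hh).toRingHom) (fun a => ?_) ?_ f
  · change MonoidAlgebra.mapDomainAlgHom ℤ_[p] ℤ_[p] φ _ = toGroupRing hh _
    rw [toGroupRing_C, AlgHom.commutes]
  · change MonoidAlgebra.mapDomainAlgHom ℤ_[p] ℤ_[p] φ _ = toGroupRing hh _
    rw [toGroupRing_one_add_X]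
    simp [hφ]

end GroupRing

/-! ### The isomorphism between `ℤ_p⟦X⟧` and the Iwasawa algebra -/

/-- The homomorphism `ℤ_p⟦X⟧ → ℤ_p[Γ / Γ_n]` that sends `1 + X` to the class of `1 + p`. -/
def toGammaRing (hp : p ≠ 2) (n : ℕ) :
    ℤ_[p]⟦X⟧ →ₐ[ℤ_[p]] MonoidAlgebra ℤ_[p] (GammaGroup p ⧸ gammaSub p n) :=
  toGroupRing (genMod_pow_eq_one hp n)

theorem mapDomain_toGammaRing (hp : p ≠ 2) (n : ℕ) (f : ℤ_[p]⟦X⟧) :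
    MonoidAlgebra.mapDomainAlgHom ℤ_[p] ℤ_[p] (gammaTransition p n) (toGammaRing hp (n + 1) f) =
      toGammaRing hp n f :=
  mapDomain_toGroupRing _ _ _ rfl f

theorem omegaPoly_dvd_of_toGammaRing_eq_zero (hp : p ≠ 2) (n : ℕ) {f : ℤ_[p]⟦X⟧}
    (h : toGammaRing hp n f = 0) : (omegaPoly p n : ℤ_[p]⟦X⟧) ∣ f :=
  omegaPoly_dvd_of_toGroupRing_eq_zero _ (genMod_pow_bijective hp n).1 h

theorem toGammaRing_surjective (hp : p ≠ 2) (n : ℕ) : Function.Surjective (toGammaRing hp n) :=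
  toGroupRing_surjective _ (genMod_pow_bijective hp n).2

theorem toGammaRing_omegaPoly (hp : p ≠ 2) (n : ℕ) :
    toGammaRing hp n (omegaPoly p n : ℤ_[p]⟦X⟧) = 0 :=
  toGroupRing_omegaPoly _

/-- The homomorphism `ℤ_p⟦X⟧ → Λ` that sends `1 + X` to `1 + p`. -/
def toLam (hp : p ≠ 2) : ℤ_[p]⟦X⟧ →ₐ[ℤ_[p]] Lam p :=
  AlgHom.codRestrict (AlgHom.pi fun n => toGammaRing hp n) (iwasawaAlgebra p)
    fun f n => mapDomain_toGammaRing hp n f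

theorem coe_toLam (hp : p ≠ 2) (f : ℤ_[p]⟦X⟧) (n : ℕ) : (toLam hp f).1 n = toGammaRing hp n f := rfl

theorem toLam_injective (hp : p ≠ 2) : Function.Injective (toLam hp) := by
  rw [injective_iff_map_eq_zero]
  intro f hf
  refine eq_zero_of_forall_omegaPoly_dvd fun n => omegaPoly_dvd_of_toGammaRing_eq_zero hp n ?_
  rw [← coe_toLam, hf]
  rfl

open PowerSeries.WithPiTopology in
instance : CompactSpace ℤ_[p]⟦X⟧ :=
  inferInstanceAs (CompactSpace ((Unit →₀ ℕ) → ℤ_[p]))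

open PowerSeries.WithPiTopology in
-- The series with prescribed image at level n form a coset of a principal ideal, which is compact
-- as a continuous image of the compact space of power series. These nonempty sets are nested, so
-- they have a common point.
theorem toLam_surjective (hp : p ≠ 2) : Function.Surjective (toLam hp) := by
  intro α
  have hset : ∀ n, ∃ f₀ : ℤ_[p]⟦X⟧, {f | toGammaRing hp n f = α.1 n} =
      Set.range fun h => f₀ + (omegaPoly p n : ℤ_[p]⟦X⟧) * h := by
    intro n
    obtain ⟨f₀, hf₀⟩ := toGammaRing_surjective hp n (α.1 n)
    refine ⟨f₀, Set.ext fun f => ⟨fun hf => ?_, ?_⟩⟩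
    · obtain ⟨h, hh⟩ := omegaPoly_dvd_of_toGammaRing_eq_zero hp n (f := f - f₀)
        (by rw [map_sub, hf₀, sub_eq_zero]; exact hf)
      exact ⟨h, by simp only [← hh]; ring⟩
    · rintro ⟨h, rfl⟩
      change toGammaRing hp n _ = _
      rw [map_add, map_mul, toGammaRing_omegaPoly, zero_mul, add_zero, hf₀]
  have hcomp : ∀ n, IsCompact {f | toGammaRing hp n f = α.1 n} := by
    intro n
    obtain ⟨f₀, h⟩ := hset n
    rw [h]
    exact isCompact_range (by fun_prop)
  obtain ⟨f, hf⟩ := IsCompact.nonempty_iInter_of_sequence_nonempty_isCompact_isClosed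
    (fun n => {f | toGammaRing hp n f = α.1 n})
    (fun n f hf => by
      change toGammaRing hp n f = α.1 n
      rw [← mapDomain_toGammaRing, hf, α.2 n])
    (fun n => toGammaRing_surjective hp n (α.1 n)) (hcomp 0) (fun n => (hcomp n).isClosed)
  exact ⟨f, Subtype.ext (funext fun n => Set.mem_iInter.1 hf n)⟩

/-- The isomorphism `ℤ_p⟦X⟧ ≃ Λ` that sends `1 + X` to `1 + p`. -/
def lamEquiv (hp : p ≠ 2) : ℤ_[p]⟦X⟧ ≃ₐ[ℤ_[p]] Lam p :=
  AlgEquiv.ofBijective (toLam hp) ⟨toLam_injective hp, toLam_surjective hp⟩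

theorem coe_lamEquiv (hp : p ≠ 2) (f : ℤ_[p]⟦X⟧) (n : ℕ) :
    (lamEquiv hp f).1 n = toGammaRing hp n f := rfl

theorem lamEquiv_symm_gammaGen (hp : p ≠ 2) :
    (lamEquiv hp).symm (groupLike (gammaGen p)) = 1 + PowerSeries.X := by
  rw [AlgEquiv.symm_apply_eq]
  refine Subtype.ext (funext fun n => ?_)
  exact (toGroupRing_one_add_X (genMod_pow_eq_one hp n)).symm

/-! ### Evaluation of power series at `(1 + p) ^ s - 1` -/

instance : IsLinearTopology ℤ_[p] ℤ_[p] :=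
  IsLinearTopology.mk_of_hasBasis ℤ_[p] (p := fun _ : ℕ => True)
    (s := fun n => Ideal.span {(p : ℤ_[p]) ^ n}) <| by
    refine ⟨fun t => ⟨fun ht => ?_, ?_⟩⟩
    · obtain ⟨ε, hε, h⟩ := Metric.mem_nhds_iff.1 ht
      obtain ⟨n, hn⟩ := PadicInt.exists_pow_neg_lt p hε
      refine ⟨n, trivial, fun x hx => h ?_⟩
      rw [mem_ball_zero_iff]
      exact ((PadicInt.norm_le_pow_iff_mem_span_pow x n).2 hx).trans_lt hn
    · rintro ⟨n, -, h⟩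
      filter_upwards [eventually_pow_dvd_sub (0 : ℤ_[p]) n] with x hx
      exact h (Ideal.mem_span_singleton.2 (by simpa using hx))

theorem hasEval_gammaPow (s : ℤ_[p]) : PowerSeries.HasEval (gammaPow s (gammaGen p) - 1) := by
  rw [PowerSeries.hasEval_def, IsTopologicallyNilpotent,
    tendsto_pow_atTop_nhds_zero_iff_norm_lt_one, PadicInt.norm_lt_one_iff_dvd]
  exact dvd_gammaPow_sub_one s _

/-- The value at `X = (1 + p) ^ s - 1` of a power series. -/
def evalAt (s : ℤ_[p]) : ℤ_[p]⟦X⟧ →ₐ[ℤ_[p]] ℤ_[p] := PowerSeries.aeval (hasEval_gammaPow s)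

open PowerSeries.WithPiTopology in
theorem continuous_evalAt (s : ℤ_[p]) : Continuous (evalAt s : ℤ_[p]⟦X⟧ → ℤ_[p]) :=
  PowerSeries.continuous_aeval (hasEval_gammaPow s)

theorem evalAt_X (s : ℤ_[p]) : evalAt s PowerSeries.X = gammaPow s (gammaGen p) - 1 := by
  rw [evalAt, ← Polynomial.coe_X, PowerSeries.aeval_coe, Polynomial.aeval_X]

theorem evalAt_C (s a : ℤ_[p]) : evalAt s (PowerSeries.C a) = a := (evalAt s).commutes a

/-- The value is y ^ (p ^ n) - 1 with y ≡ 1 modulo p, and each p-th power gains a factor p. -/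
theorem toZModPow_comp_evalAt_omegaPoly (s : ℤ_[p]) (n : ℕ) :
    PadicInt.toZModPow (n + 1) (evalAt s (omegaPoly p n : ℤ_[p]⟦X⟧)) = 0 := by
  rw [evalAt, PowerSeries.aeval_coe]
  simp only [omegaPoly, map_sub, map_pow, map_add, map_one, Polynomial.aeval_X, add_sub_cancel]
  rw [sub_eq_zero, ← map_one (PadicInt.toZModPow (n + 1)), ← map_pow, toZModPow_eq_iff]
  obtain ⟨z, hz⟩ := dvd_gammaPow_sub_one s (gammaGen p)
  rw [eq_add_of_sub_eq' hz]
  simpa [add_comm] using dvd_sub_pow_of_dvd_sub (p := p) (R := ℤ_[p]) (a := 1 + p * z) (b := 1)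
    (by simp) n

/-- Power series take congruent values at congruent points. -/
theorem pow_dvd_evalAt_sub_evalAt {s t : ℤ_[p]} {n : ℕ}
    (h : (p : ℤ_[p]) ^ (n + 1) ∣ gammaPow s (gammaGen p) - gammaPow t (gammaGen p))
    (f : ℤ_[p]⟦X⟧) : (p : ℤ_[p]) ^ (n + 1) ∣ evalAt s f - evalAt t f := by
  rw [← toZModPow_eq_iff] at h ⊢
  have key := ringHom_ext_of_omegaPoly n
    (f := (PadicInt.toZModPow (n + 1)).comp (evalAt s).toRingHom)
    (g := (PadicInt.toZModPow (n + 1)).comp (evalAt t).toRingHom)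
    (fun a => by
      change PadicInt.toZModPow (n + 1) (evalAt s _) = PadicInt.toZModPow (n + 1) (evalAt t _)
      rw [evalAt_C, evalAt_C])
    (by
      change PadicInt.toZModPow (n + 1) (evalAt s _) = PadicInt.toZModPow (n + 1) (evalAt t _)
      rw [evalAt_X, evalAt_X, map_sub, map_sub, h])
    (toZModPow_comp_evalAt_omegaPoly s n)
  exact congr($key f)

theorem continuous_evalAt_left (f : ℤ_[p]⟦X⟧) : Continuous fun s => evalAt s f := by
  refine continuous_iff_continuousAt.2 fun s => tendsto_of_forall_pow_dvd_sub fun n => ?_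
  filter_upwards [(continuous_gammaPow (gammaGen p)).continuousAt.eventually
    (eventually_pow_dvd_sub (gammaPow s (gammaGen p)) (n + 1))] with t ht
  exact (pow_dvd_pow _ n.le_succ).trans (pow_dvd_evalAt_sub_evalAt ht f)

theorem evalAt_zero (f : ℤ_[p]⟦X⟧) : evalAt 0 f = PowerSeries.constantCoeff f := by
  obtain ⟨g, hg⟩ : PowerSeries.X ∣ f - PowerSeries.C (PowerSeries.constantCoeff f) := by
    rw [PowerSeries.X_dvd_iff]; simp
  rw [eq_add_of_sub_eq hg, map_add, map_mul, evalAt_X, evalAt_C, gammaPow_zero]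
  simp

theorem dvd_evalAt_sub_constantCoeff (s : ℤ_[p]) (f : ℤ_[p]⟦X⟧) :
    (p : ℤ_[p]) ∣ evalAt s f - PowerSeries.constantCoeff f := by
  have h := pow_dvd_evalAt_sub_evalAt (s := s) (t := 0) (n := 0)
    (by simpa [gammaPow_zero] using dvd_gammaPow_sub_one s (gammaGen p)) f
  simpa [evalAt_zero] using h

/-- The values of an element of `Λ` at the characters `x ↦ x ^ s` are the values of the
corresponding power series at `(1 + p) ^ s - 1`. -/
theorem hasValue_lamEquiv (hp : p ≠ 2) (s : ℤ_[p]) (f : ℤ_[p]⟦X⟧) :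
    HasValue (gammaPow s) (lamEquiv hp f) (evalAt s f : ℚ_[p]) := by
  refine (continuous_subtype_val.tendsto _).comp (tendsto_of_forall_pow_dvd_sub fun m => ?_)
  filter_upwards [eventually_ge_atTop m] with n hn
  refine (pow_dvd_pow _ (hn.trans n.le_succ)).trans ?_
  rw [← toZModPow_eq_iff, coe_lamEquiv]
  -- Modulo p ^ (n + 1) the function x ↦ x ^ s factors through Γ / Γ_n, so the finite sum is the
  -- value of a ring homomorphism φ, which can be compared with evaluation on constants and on 1 +
  -- X.
  let φ := MonoidAlgebra.liftNCRingHom (PadicInt.toZModPow (p := p) (n + 1)) (gammaPowMod s n)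
    (fun _ _ => Commute.all _ _)
  have h := ringHom_comp_toGroupRing (genMod_pow_eq_one hp n) φ
    (ψ := (PadicInt.toZModPow (n + 1)).comp (evalAt s).toRingHom)
    (fun a => by
      change _ = PadicInt.toZModPow (n + 1) (evalAt s _)
      rw [evalAt_C]
      simp [φ, MonoidAlgebra.liftNCRingHom])
    (by
      change _ = PadicInt.toZModPow (n + 1) (evalAt s _)
      rw [map_add, map_one, evalAt_X, add_sub_cancel, ← gammaPowMod_mk]
      simp [φ, MonoidAlgebra.liftNCRingHom]
      rfl) f
  refine Eq.trans ?_ h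
  change _ = (toGammaRing hp n f).coeff.sum
    fun c a => PadicInt.toZModPow (n + 1) a * gammaPowMod s n c
  rw [map_finsuppSum]
  refine Finset.sum_congr rfl fun c _ => ?_
  dsimp only
  rw [map_mul, ← gammaPowMod_mk, QuotientGroup.out_eq']

/-- The power series of an element of `Γ`. -/
def gammaSeries (hp : p ≠ 2) (x : GammaGroup p) : ℤ_[p]⟦X⟧ := (lamEquiv hp).symm (groupLike x)

theorem evalAt_gammaSeries (hp : p ≠ 2) (s : ℤ_[p]) (x : GammaGroup p) :
    evalAt s (gammaSeries hp x) = gammaPow s x := by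
  have h := hasValue_lamEquiv hp s (gammaSeries hp x)
  rw [gammaSeries, AlgEquiv.apply_symm_apply] at h
  have h' : HasValue (gammaPow s) (groupLike x) (gammaPow s x : ℚ_[p]) := by
    refine (continuous_subtype_val.tendsto _).comp (tendsto_of_forall_pow_dvd_sub fun m => ?_)
    filter_upwards [eventually_ge_atTop m] with n hn
    refine (pow_dvd_pow _ (hn.trans n.le_succ)).trans ?_
    have hs : (((groupLike x).1 n).coeff.sum fun c a => a * gammaPow s c.out) =
        gammaPow s (QuotientGroup.mk x : GammaGroup p ⧸ gammaSub p n).out := by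
      simp [groupLike, MonoidAlgebra.of_apply]
    rw [hs]
    exact pow_dvd_gammaPow_sub s (mk_eq_mk_iff.1 (QuotientGroup.out_eq' _).symm)
  exact Subtype.ext (tendsto_nhds_unique h h')

/-! ### Power sums and Bernoulli numbers -/

theorem sum_range_mul_eq {M : Type*} [AddCommMonoid M] (f : ℕ → M) (m n : ℕ) :
    ∑ a ∈ Finset.range (m * n), f a =
      ∑ i ∈ Finset.range m, ∑ a ∈ Finset.range n, f (a + n * i) := by
  induction m with
  | zero => simp
  | succ m ih =>
    rw [Nat.succ_mul, Finset.sum_range_add, ih, Finset.sum_range_succ]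
    exact congrArg _ (Finset.sum_congr rfl fun a _ => by rw [add_comm, mul_comm])

/-- Pairing a with m - a shows that m divides twice the sum, and m is odd. -/
theorem dvd_sum_range_pow_of_odd {m j : ℕ} (hm : Odd m) (hj : Odd j) :
    m ∣ ∑ a ∈ Finset.range m, a ^ j := by
  have h1 : m ∣ 2 * ∑ a ∈ Finset.range (m + 1), a ^ j := by
    rw [two_mul]
    nth_rewrite 2 [← Finset.sum_range_reflect]
    rw [← Finset.sum_add_distrib]
    refine Finset.dvd_sum fun a ha => ?_
    have ha' : a ≤ m := Nat.lt_succ_iff.1 (Finset.mem_range.1 ha)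
    have := hj.nat_add_dvd_pow_add_pow a (m - a)
    rwa [Nat.add_sub_cancel' ha'] at this
  have h2 := (Nat.Coprime.dvd_mul_left (Nat.coprime_two_right.2 hm)).1 h1
  rw [Finset.sum_range_succ] at h2
  exact (Nat.dvd_add_left (dvd_pow_self m hj.pos.ne')).1 h2

variable (p) in
/-- The sum of the `k`-th powers of the natural numbers less than `p ^ N`. -/
def powerSum (k N : ℕ) : ℤ_[p] := ∑ a ∈ Finset.range (p ^ N), (a : ℤ_[p]) ^ k

/-- Write the summation index as a + p ^ N i and expand to first order. The linear term contains the
sum of the odd powers a ^ (k - 1), which gives another factor p ^ N. Keeping the factor k makes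
later division by k harmless. -/
theorem mul_dvd_powerSum_succ_sub (hp : p ≠ 2) {k N : ℕ} (hk : Even k) (hk0 : k ≠ 0)
    (hN : 1 ≤ N) :
    (k : ℤ_[p]) * (p : ℤ_[p]) ^ (2 * N) ∣ powerSum p k (N + 1) - p * powerSum p k N := by
  have hodd : Odd (k - 1) := Nat.Even.sub_odd (Nat.one_le_iff_ne_zero.2 hk0) hk odd_one
  have h1 : (p : ℤ_[p]) ^ N ∣ powerSum p (k - 1) N := by
    rw [powerSum]
    exact_mod_cast Nat.cast_dvd_cast (α := ℤ_[p]) (dvd_sum_range_pow_of_odd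
      (((Fact.out : p.Prime).odd_of_ne_two hp).pow (n := N)) hodd)
  have h2 : powerSum p k (N + 1) - p * powerSum p k N =
      ∑ i ∈ Finset.range p, ∑ a ∈ Finset.range (p ^ N),
        (((a : ℤ_[p]) + (p : ℤ_[p]) ^ N * i) ^ k - (a : ℤ_[p]) ^ k -
          k * (p : ℤ_[p]) ^ N * (a : ℤ_[p]) ^ (k - 1) * i) +
      k * (p : ℤ_[p]) ^ N * powerSum p (k - 1) N * ∑ i ∈ Finset.range p, (i : ℤ_[p]) := by
    simp only [Finset.sum_sub_distrib, Finset.sum_const, Finset.card_range, nsmul_eq_mul]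
    have h3 : powerSum p k (N + 1) = ∑ i ∈ Finset.range p, ∑ a ∈ Finset.range (p ^ N),
        ((a : ℤ_[p]) + (p : ℤ_[p]) ^ N * i) ^ k := by
      rw [powerSum, pow_succ', sum_range_mul_eq]
      simp
    have h4 : ∑ i ∈ Finset.range p, ∑ a ∈ Finset.range (p ^ N),
        (k * (p : ℤ_[p]) ^ N * (a : ℤ_[p]) ^ (k - 1) * i) =
        k * (p : ℤ_[p]) ^ N * powerSum p (k - 1) N * ∑ i ∈ Finset.range p, (i : ℤ_[p]) := by
      rw [Finset.mul_sum, powerSum]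
      refine Finset.sum_congr rfl fun i _ => ?_
      rw [Finset.mul_sum, Finset.sum_mul]
    rw [h3, h4, powerSum]
    ring
  rw [h2]
  refine dvd_add (Finset.dvd_sum fun i _ => Finset.dvd_sum fun a _ =>
    mul_dvd_add_pow_sub hp hN _ _ _) (Dvd.dvd.mul_right ?_ _)
  rw [two_mul, pow_add, ← mul_assoc]
  exact mul_dvd_mul_left _ h1

/-- By Faulhaber's formula the quotient is a polynomial in p ^ N with constant term B_k. -/
theorem tendsto_powerSum_div (k : ℕ) :
    Tendsto (fun N => (powerSum p k N : ℚ_[p]) / (p : ℚ_[p]) ^ N) atTop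
      (𝓝 ((bernoulli k : ℚ) : ℚ_[p])) := by
  have hp0 : (p : ℚ_[p]) ≠ 0 := by exact_mod_cast (Fact.out : p.Prime).ne_zero
  let g : ℚ_[p] → ℚ_[p] := fun x => ∑ i ∈ Finset.range (k + 1),
    ((bernoulli i : ℚ) : ℚ_[p]) * ((k + 1).choose i : ℕ) * x ^ (k - i) / (k + 1)
  have hg : Continuous g := by fun_prop
  have hg0 : g 0 = ((bernoulli k : ℚ) : ℚ_[p]) := by
    have hk : (k : ℚ_[p]) + 1 ≠ 0 := by exact_mod_cast k.succ_ne_zero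
    simp only [g]
    rw [Finset.sum_range_succ, Finset.sum_eq_zero, zero_add]
    · simp [hk]
    · intro i hi
      rw [zero_pow (Nat.sub_ne_zero_of_lt (Finset.mem_range.1 hi))]
      simp
  have hlim : Tendsto (fun N : ℕ => (p : ℚ_[p]) ^ N) atTop (𝓝 0) := by
    rw [tendsto_pow_atTop_nhds_zero_iff_norm_lt_one]
    exact Padic.norm_p_lt_one
  rw [← hg0]
  refine ((hg.tendsto 0).comp hlim).congr fun N => ?_
  have h := congr(((($(sum_range_pow (p ^ N) k)) : ℚ) : ℚ_[p]))
  have hS : (powerSum p k N : ℚ_[p]) = ∑ a ∈ Finset.range (p ^ N), (a : ℚ_[p]) ^ k := by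
    simp [powerSum]
  rw [eq_div_iff (pow_ne_zero N hp0), hS]
  push_cast at h
  rw [h, Function.comp_apply, Finset.sum_mul]
  refine Finset.sum_congr rfl fun i hi => ?_
  have : k + 1 - i = k - i + 1 := by
    have := Finset.mem_range.1 hi
    omega
  rw [this, pow_succ]
  ring

theorem norm_bernoulli_sub_powerSum_le (hp : p ≠ 2) {k : ℕ} (hk : Even k) (hk0 : k ≠ 0) (M : ℕ) :
    ‖((bernoulli k : ℚ) : ℚ_[p]) - (powerSum p k (M + 1) : ℚ_[p]) / (p : ℚ_[p]) ^ (M + 1)‖ ≤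
      ‖(k : ℚ_[p])‖ * (p : ℝ) ^ (-M : ℤ) := by
  have hp0 : (p : ℚ_[p]) ≠ 0 := by exact_mod_cast (Fact.out : p.Prime).ne_zero
  have hp1 : (1 : ℝ) ≤ p := by exact_mod_cast (Fact.out : p.Prime).one_le
  set x : ℕ → ℚ_[p] := fun N => (powerSum p k N : ℚ_[p]) / (p : ℚ_[p]) ^ N with hx
  have hstep : ∀ N, ‖x (N + 2) - x (N + 1)‖ ≤ ‖(k : ℚ_[p])‖ * (p : ℝ) ^ (-N : ℤ) := by
    intro N
    obtain ⟨z, hz⟩ := mul_dvd_powerSum_succ_sub hp hk hk0 (Nat.le_add_left 1 N)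
    have hz' : (powerSum p k (N + 2) : ℚ_[p]) = p * powerSum p k (N + 1) +
        k * (p : ℚ_[p]) ^ (2 * (N + 1)) * z := by
      have := congr((($hz : ℤ_[p]) : ℚ_[p]))
      push_cast at this
      linear_combination this
    have he : x (N + 2) - x (N + 1) = k * (p : ℚ_[p]) ^ N * z := by
      simp only [hx, hz']
      field_simp
      ring
    rw [he, norm_mul, norm_mul, norm_pow, Padic.norm_p, inv_pow, zpow_neg, zpow_natCast]
    exact mul_le_of_le_one_right (by positivity) (PadicInt.norm_le_one z)
  have hall : ∀ N, M ≤ N → ‖x (N + 1) - x (M + 1)‖ ≤ ‖(k : ℚ_[p])‖ * (p : ℝ) ^ (-M : ℤ) := by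
    intro N hN
    induction N, hN using Nat.le_induction with
    | base => simp only [sub_self, norm_zero]; positivity
    | succ N hN ih =>
      have : x (N + 1 + 1) - x (M + 1) = (x (N + 2) - x (N + 1)) + (x (N + 1) - x (M + 1)) := by
        ring
      rw [this]
      refine (Padic.nonarchimedean _ _).trans (max_le ((hstep N).trans ?_) ih)
      gcongr
  refine le_of_tendsto ((((tendsto_powerSum_div k).comp (tendsto_add_atTop_nat 1)).sub
    tendsto_const_nhds).norm) ?_
  filter_upwards [eventually_ge_atTop M] with N hN
  exact hall N hN

/-- Multiplication by `c` permutes the residues modulo `m`. -/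
theorem sum_range_mul_mod {M : Type*} [AddCommMonoid M] {c m : ℕ} (h : c.Coprime m) (f : ℕ → M) :
    ∑ a ∈ Finset.range m, f (c * a % m) = ∑ a ∈ Finset.range m, f a := by
  have hmaps : Set.MapsTo (fun a => c * a % m) (Finset.range m) (Finset.range m) := by
    intro a ha
    have ha' := Finset.mem_range.1 (Finset.mem_coe.1 ha)
    exact Finset.mem_coe.2 (Finset.mem_range.2 (Nat.mod_lt _ (by omega)))
  have hinj : Set.InjOn (fun a => c * a % m) (Finset.range m) := by
    intro a ha b hb hab
    exact (Nat.ModEq.cancel_left_of_coprime (Nat.coprime_comm.1 h) hab).eq_of_lt_of_lt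
      (Finset.mem_range.1 (Finset.mem_coe.1 ha)) (Finset.mem_range.1 (Finset.mem_coe.1 hb))
  exact Finset.sum_nbij (fun a => c * a % m) hmaps hinj
    (Finset.surjOn_of_injOn_of_card_le _ hmaps hinj le_rfl) fun _ _ => rfl

variable (p) in
/-- The sum of `- ⌊c a / p ^ N⌋ (c a) ^ (k - 1)` over `a < p ^ N`. -/
def floorSum (c k N : ℕ) : ℤ_[p] :=
  -∑ a ∈ Finset.range (p ^ N), ((c * a / p ^ N : ℕ) : ℤ_[p]) * ((c * a : ℕ) : ℤ_[p]) ^ (k - 1)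

/-- Replace a by the residue c a - p ^ N ⌊c a / p ^ N⌋, which only permutes the terms of the power
sum, and expand to first order. -/
theorem mul_dvd_powerSum_sub_floorSum (hp : p ≠ 2) {c : ℕ} (hc : c.Coprime p) (k : ℕ) {N : ℕ}
    (hN : 1 ≤ N) : (k : ℤ_[p]) * (p : ℤ_[p]) ^ (2 * N) ∣
      (1 - (c : ℤ_[p]) ^ k) * powerSum p k N - k * (p : ℤ_[p]) ^ N * floorSum p c k N := by
  have h1 : powerSum p k N = ∑ a ∈ Finset.range (p ^ N), (((c * a : ℕ) : ℤ_[p]) +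
      (p : ℤ_[p]) ^ N * (-((c * a / p ^ N : ℕ) : ℤ_[p]))) ^ k := by
    rw [powerSum, ← sum_range_mul_mod (hc.pow_right N) fun a => (a : ℤ_[p]) ^ k]
    refine Finset.sum_congr rfl fun a _ => ?_
    have := congr((($(Nat.mod_add_div (c * a) (p ^ N)) : ℕ) : ℤ_[p]))
    push_cast at this ⊢
    rw [← this]
    ring
  have h2 : (1 - (c : ℤ_[p]) ^ k) * powerSum p k N - k * (p : ℤ_[p]) ^ N * floorSum p c k N =
      ∑ a ∈ Finset.range (p ^ N), ((((c * a : ℕ) : ℤ_[p]) +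
      (p : ℤ_[p]) ^ N * (-((c * a / p ^ N : ℕ) : ℤ_[p]))) ^ k - ((c * a : ℕ) : ℤ_[p]) ^ k -
      k * (p : ℤ_[p]) ^ N * ((c * a : ℕ) : ℤ_[p]) ^ (k - 1) *
        (-((c * a / p ^ N : ℕ) : ℤ_[p]))) := by
    rw [Finset.sum_sub_distrib, Finset.sum_sub_distrib, ← h1, sub_mul, one_mul]
    congr 1
    · rw [powerSum, Finset.mul_sum]
      simp [mul_pow]
    · rw [floorSum, ← Finset.sum_neg_distrib, Finset.mul_sum]
      exact Finset.sum_congr rfl fun a _ => by ring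
  rw [h2]
  exact Finset.dvd_sum fun a _ => mul_dvd_add_pow_sub hp hN _ _ _

theorem norm_bernoulli_sub_floorSum_le (hp : p ≠ 2) {c : ℕ} (hc : c.Coprime p) {k : ℕ}
    (hk : Even k) (hk0 : k ≠ 0) (M : ℕ) :
    ‖(1 - (c : ℚ_[p]) ^ k) * ((bernoulli k : ℚ) : ℚ_[p]) / k - (floorSum p c k (M + 1) : ℚ_[p])‖ ≤
      (p : ℝ) ^ (-M : ℤ) := by
  have hp0 : (p : ℚ_[p]) ≠ 0 := by exact_mod_cast (Fact.out : p.Prime).ne_zero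
  have hp1 : (1 : ℝ) ≤ p := by exact_mod_cast (Fact.out : p.Prime).one_le
  have hkp : (k : ℚ_[p]) ≠ 0 := by exact_mod_cast hk0
  obtain ⟨z, hz⟩ := mul_dvd_powerSum_sub_floorSum hp hc k (Nat.le_add_left 1 M)
  have hz' := congr((($hz : ℤ_[p]) : ℚ_[p]))
  push_cast at hz'
  have he : (1 - (c : ℚ_[p]) ^ k) * ((bernoulli k : ℚ) : ℚ_[p]) / k -
      (floorSum p c k (M + 1) : ℚ_[p]) = ((1 - (c : ℤ_[p]) ^ k : ℤ_[p]) : ℚ_[p]) *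
      ((((bernoulli k : ℚ) : ℚ_[p]) - (powerSum p k (M + 1) : ℚ_[p]) / (p : ℚ_[p]) ^ (M + 1)) / k) +
      (p : ℚ_[p]) ^ (M + 1) * z := by
    push_cast
    field_simp
    linear_combination hz'
  rw [he]
  refine (Padic.nonarchimedean _ _).trans (max_le ?_ ?_)
  · rw [norm_mul, norm_div]
    have hk' : 0 < ‖(k : ℚ_[p])‖ := norm_pos_iff.2 hkp
    refine (mul_le_of_le_one_left (by positivity) (PadicInt.norm_le_one _)).trans ?_
    rw [div_le_iff₀ hk', mul_comm]
    exact norm_bernoulli_sub_powerSum_le hp hk hk0 M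
  · rw [norm_mul, norm_pow, Padic.norm_p, inv_pow, ← zpow_natCast, ← zpow_neg]
    refine (mul_le_of_le_one_right (by positivity) (PadicInt.norm_le_one z)).trans ?_
    gcongr
    omega

theorem dvd_powerSum_one_add_one {k : ℕ} (hk0 : k ≠ 0) (hk : p - 1 ∣ k) :
    (p : ℤ_[p]) ∣ powerSum p k 1 + 1 := by
  obtain ⟨m, hm⟩ := Nat.exists_eq_succ_of_ne_zero (Fact.out : p.Prime).ne_zero
  have h : ((∑ a ∈ Finset.range p, a ^ k + 1 : ℕ) : ZMod p) = 0 := by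
    have h1 : ∀ a ∈ Finset.range m, ((a + 1 : ℕ) : ZMod p) ^ k = 1 := by
      intro a ha
      obtain ⟨j, rfl⟩ := hk
      rw [pow_mul, ZMod.pow_card_sub_one_eq_one, one_pow]
      rw [Ne, ZMod.natCast_eq_zero_iff]
      exact Nat.not_dvd_of_pos_of_lt a.succ_pos (by have := Finset.mem_range.1 ha; omega)
    have h2 : ∑ a ∈ Finset.range p, (a : ZMod p) ^ k = m := by
      conv_lhs => rw [show Finset.range p = Finset.range (m + 1) by rw [hm]]
      rw [Finset.sum_range_succ', Finset.sum_congr rfl h1]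
      simp [hk0]
    push_cast
    rw [h2]
    have : ((m + 1 : ℕ) : ZMod p) = 0 := by rw [ZMod.natCast_eq_zero_iff, hm]
    exact_mod_cast this
  have h3 := Nat.cast_dvd_cast (α := ℤ_[p]) ((ZMod.natCast_eq_zero_iff _ _).1 h)
  rw [powerSum, pow_one]
  exact_mod_cast h3

/-- For `k` divisible by `p - 1`, the number `(1 - (1 + p) ^ k) B_k / k` is congruent to `1`. -/
theorem norm_bernoulli_sub_one_le (hp : p ≠ 2) {k : ℕ} (hk : Even k) (hk0 : k ≠ 0)
    (hpk : p - 1 ∣ k) :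
    ‖(1 - ((1 + p : ℕ) : ℚ_[p]) ^ k) * ((bernoulli k : ℚ) : ℚ_[p]) / k - 1‖ < 1 := by
  have hp0 : (p : ℚ_[p]) ≠ 0 := by exact_mod_cast (Fact.out : p.Prime).ne_zero
  have hkp : (k : ℚ_[p]) ≠ 0 := by exact_mod_cast hk0
  obtain ⟨z, hz⟩ := exists_one_add_pow_sub_one hp k
  obtain ⟨w, hw⟩ := dvd_powerSum_one_add_one hk0 hpk
  have hB := norm_bernoulli_sub_powerSum_le hp hk hk0 0
  simp only [Nat.cast_zero, neg_zero, zpow_zero, mul_one, zero_add, pow_one] at hB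
  obtain ⟨y, hy⟩ : ∃ y : ℤ_[p], ((bernoulli k : ℚ) : ℚ_[p]) - (powerSum p k 1 : ℚ_[p]) / p =
      k * y := by
    refine ⟨⟨(((bernoulli k : ℚ) : ℚ_[p]) - (powerSum p k 1 : ℚ_[p]) / p) / k, ?_⟩, ?_⟩
    · rw [norm_div, div_le_one (norm_pos_iff.2 hkp)]
      exact hB
    · field_simp
  have hz' := congr((($hz : ℤ_[p]) : ℚ_[p]))
  have hw' := congr((($hw : ℤ_[p]) : ℚ_[p]))
  push_cast at hz' hw'
  -- The factor (1 - (1 + p) ^ k) / k is -p (1 + p z), and p B_k ≡ -1 modulo p.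
  have he : (1 - ((1 + p : ℕ) : ℚ_[p]) ^ k) * ((bernoulli k : ℚ) : ℚ_[p]) / k - 1 =
      ((p * (z - (1 + p * z) * (w + k * y)) : ℤ_[p]) : ℚ_[p]) := by
    push_cast
    have h1 : (1 - (1 + (p : ℚ_[p])) ^ k) = -(k * p * (1 + p * z)) := by linear_combination -hz'
    have h2 : ((bernoulli k : ℚ) : ℚ_[p]) = (p * w - 1) / p + k * y := by
      rw [← hw']; linear_combination hy
    rw [h1, h2]
    field_simp
    ring
  rw [he, ← PadicInt.norm_def, PadicInt.norm_lt_one_iff_dvd]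
  exact dvd_mul_right _ _

/-! ### Interpolation of the powers of a unit -/

/-- A power series whose value at `(1 + p) ^ k - 1` is `b ^ k` for every natural number `k`
congruent to `v` modulo `p - 1`. -/
def weightSeries (hp : p ≠ 2) (v : ℕ) (b : ℤ_[p]ˣ) : ℤ_[p]⟦X⟧ :=
  PowerSeries.C ((omegaPart b : ℤ_[p]) ^ v) * gammaSeries hp (gammaPart b)

theorem evalAt_weightSeries (hp : p ≠ 2) {k v : ℕ} (h : k ≡ v [MOD p - 1]) (b : ℤ_[p]ˣ) :
    evalAt (k : ℤ_[p]) (weightSeries hp v b) = (b : ℤ_[p]) ^ k := by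
  have hω : omegaPart b ^ v = omegaPart b ^ k := pow_eq_pow_of_modEq h.symm (omegaPart_pow b)
  rw [weightSeries, map_mul, evalAt_C, evalAt_gammaSeries, gammaPow_natCast,
    ← Units.val_pow_eq_pow_val, hω, Units.val_pow_eq_pow_val, ← mul_pow, ← Units.val_mul,
    ← omegaPart_mul_gammaPart]

theorem isUnit_natCast {b : ℕ} (h : b.Coprime p) : IsUnit (b : ℤ_[p]) := by
  rw [PadicInt.isUnit_iff, PadicInt.norm_natCast_eq_one_iff]
  exact h.symm

variable (p) in
/-- A natural number as a unit of `ℤ_[p]`; the value is `1` if it is divisible by `p`. -/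
def natUnit (b : ℕ) : ℤ_[p]ˣ :=
  open Classical in if h : IsUnit (b : ℤ_[p]) then h.unit else 1

theorem coe_natUnit {b : ℕ} (h : b.Coprime p) : (natUnit p b : ℤ_[p]) = b := by
  rw [natUnit, dif_pos (isUnit_natCast h), IsUnit.unit_spec]

/-! ### Interpolation of the numbers `(1 - c ^ k) B_k / k` -/

/-- The element `- ∑ ⌊c a / p ^ N⌋ (c a)⁻¹ ω(c a) ^ v [⟨c a⟩]`, where `a` runs through the natural
numbers less than `p ^ N` and prime to `p`. -/
def floorSeries (hp : p ≠ 2) (c v N : ℕ) : ℤ_[p]⟦X⟧ :=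
  -∑ a ∈ Finset.range (p ^ N) with ¬ p ∣ a,
    PowerSeries.C (((c * a / p ^ N : ℕ) : ℤ_[p]) * ((natUnit p (c * a))⁻¹ : ℤ_[p]ˣ)) *
      weightSeries hp v (natUnit p (c * a))

theorem evalAt_floorSeries (hp : p ≠ 2) {c : ℕ} (hc : c.Coprime p) {v j : ℕ}
    (h : j + 1 ≡ v [MOD p - 1]) (N : ℕ) :
    evalAt ((j + 1 : ℕ) : ℤ_[p]) (floorSeries hp c v N) =
      -∑ a ∈ Finset.range (p ^ N) with ¬ p ∣ a,
        ((c * a / p ^ N : ℕ) : ℤ_[p]) * ((c * a : ℕ) : ℤ_[p]) ^ j := by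
  rw [floorSeries, map_neg, map_sum]
  congr 1
  refine Finset.sum_congr rfl fun a ha => ?_
  have hca : (c * a).Coprime p := Nat.Coprime.mul_left hc
    ((Nat.coprime_comm.1 ((Nat.Prime.coprime_iff_not_dvd Fact.out).2 (Finset.mem_filter.1 ha).2)))
  rw [map_mul, evalAt_C, evalAt_weightSeries hp h, pow_succ', mul_assoc, ← mul_assoc _ _ (_ ^ j),
    Units.inv_mul, one_mul, coe_natUnit hca]

/-- The two sides differ by the terms with p ∣ a, each a multiple of (c a) ^ j. -/
theorem pow_dvd_floorSum_sub_evalAt (hp : p ≠ 2) {c : ℕ} (hc : c.Coprime p) {v j : ℕ}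
    (h : j + 1 ≡ v [MOD p - 1]) (N : ℕ) :
    (p : ℤ_[p]) ^ j ∣
      floorSum p c (j + 1) N - evalAt ((j + 1 : ℕ) : ℤ_[p]) (floorSeries hp c v N) := by
  rw [evalAt_floorSeries hp hc h, floorSum, Nat.add_sub_cancel,
    ← Finset.sum_filter_add_sum_filter_not _ (fun a => p ∣ a), neg_add, add_sub_cancel_right,
    dvd_neg]
  refine Finset.dvd_sum fun a ha => Dvd.dvd.mul_left (pow_dvd_pow_of_dvd ?_ j) _
  exact Nat.cast_dvd_cast ((Finset.mem_filter.1 ha).2.mul_left c)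

open PowerSeries.WithPiTopology in
/-- There is a power series that interpolates the numbers `(1 - c ^ k) B_k / k`, up to an error
divisible by `p ^ (k - 1)`. -/
theorem exists_interpolation (hp : p ≠ 2) {c : ℕ} (hc : c.Coprime p) (v : ℕ) :
    ∃ F : ℤ_[p]⟦X⟧, ∀ j : ℕ, Even (j + 1) → j + 1 ≡ v [MOD p - 1] →
      ‖(1 - (c : ℚ_[p]) ^ (j + 1)) * ((bernoulli (j + 1) : ℚ) : ℚ_[p]) / (j + 1 : ℕ) -
        (evalAt ((j + 1 : ℕ) : ℤ_[p]) F : ℚ_[p])‖ ≤ (p : ℝ) ^ (-j : ℤ) := by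
  have hp1 : (1 : ℝ) ≤ p := by exact_mod_cast (Fact.out : p.Prime).one_le
  -- Convergence of the series is not needed: any cluster point works, since for each j the required
  -- bound is a closed condition that holds from level j on.
  obtain ⟨F, hF⟩ := exists_clusterPt_of_compactSpace
    (map (fun M => floorSeries hp c v (M + 1)) atTop)
  refine ⟨F, fun j hj hv => ?_⟩
  set D : ℚ_[p] := (1 - (c : ℚ_[p]) ^ (j + 1)) * ((bernoulli (j + 1) : ℚ) : ℚ_[p]) / (j + 1 : ℕ)
  have hclosed : IsClosed {G : ℤ_[p]⟦X⟧ |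
      ‖D - (evalAt ((j + 1 : ℕ) : ℤ_[p]) G : ℚ_[p])‖ ≤ (p : ℝ) ^ (-j : ℤ)} :=
    isClosed_le ((continuous_const.sub
      (continuous_subtype_val.comp (continuous_evalAt _))).norm) continuous_const
  refine hclosed.closure_subset (mem_closure_iff_clusterPt.2 (hF.mono (le_principal_iff.2 ?_)))
  rw [mem_map]
  filter_upwards [eventually_ge_atTop j] with M hM
  have h1 := norm_bernoulli_sub_floorSum_le hp hc hj j.succ_ne_zero M
  have h2 := (pow_dvd_iff_norm_le _ _).1 (pow_dvd_floorSum_sub_evalAt hp hc hv (M + 1))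
  rw [PadicInt.norm_def, PadicInt.coe_sub] at h2
  have := Padic.nonarchimedean (D - (floorSum p c (j + 1) (M + 1) : ℚ_[p]))
    ((floorSum p c (j + 1) (M + 1) : ℚ_[p]) -
      (evalAt ((j + 1 : ℕ) : ℤ_[p]) (floorSeries hp c v (M + 1)) : ℚ_[p]))
  rw [sub_add_sub_cancel] at this
  refine this.trans (max_le (h1.trans ?_) h2)
  gcongr

/-! ### The filter of weights -/

theorem even_of_natCast_eq (hp : p ≠ 2) {u : ZMod (p - 1)} (hu : Even u) {k : ℕ}
    (hk : (k : ZMod (p - 1)) = u) : Even k := by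
  obtain ⟨r, rfl⟩ := hu
  have h2 : 2 ∣ p - 1 := ((Fact.out : p.Prime).even_sub_one hp).two_dvd
  have h := congr(ZMod.castHom h2 (ZMod 2) $hk)
  rw [map_natCast, map_add, CharTwo.add_self_eq_zero] at h
  exact ZMod.natCast_eq_zero_iff_even.1 h

/-- Chinese remainder theorem for the coprime moduli p ^ m and p - 1. A multiple of their product is
added to make k large. -/
theorem exists_natCast_approx (s : ℤ_[p]) (u : ZMod (p - 1)) (m : ℕ) :
    ∃ k : ℕ, m ≤ k ∧ (p : ℤ_[p]) ^ m ∣ (k : ℤ_[p]) - s ∧ (k : ZMod (p - 1)) = u := by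
  have hpp : p.Prime := Fact.out
  have : NeZero (p - 1) := ⟨by have := hpp.two_le; omega⟩
  have : NeZero (p ^ m) := ⟨(pow_pos hpp.pos m).ne'⟩
  have hco : (p ^ m).Coprime (p - 1) := Nat.Coprime.pow_left m
    ((Nat.coprime_self_sub_right hpp.one_le).2 (Nat.coprime_one_right p))
  obtain ⟨k, hk1, hk2⟩ := Nat.chineseRemainder hco (PadicInt.toZModPow m s).val u.val
  refine ⟨k + p ^ m * (p - 1) * m, ?_, ?_, ?_⟩
  · have : 1 ≤ p ^ m * (p - 1) := Nat.one_le_iff_ne_zero.2 (NeZero.ne _)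
    nlinarith
  · rw [← toZModPow_eq_iff, map_natCast, ← ZMod.natCast_zmod_val (PadicInt.toZModPow m s),
      ZMod.natCast_eq_natCast_iff]
    rw [mul_assoc]
    simpa [Nat.ModEq] using hk1
  · rw [← ZMod.natCast_zmod_val u, ZMod.natCast_eq_natCast_iff]
    rw [mul_comm (p ^ m), mul_assoc]
    simpa [Nat.ModEq] using hk2

/-- This makes limits along the filter unique, so that `limUnder` returns the actual limit. -/
theorem weightFilter_neBot (hp : p ≠ 2) (s : ℤ_[p]) {u : ZMod (p - 1)} (hu : Even u) :
    (weightFilter p (s, u)).NeBot := by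
  choose k hk1 hk2 hk3 using exists_natCast_approx s u
  refine Tendsto.neBot (f := k) (x := atTop) ?_
  refine tendsto_inf.2 ⟨tendsto_inf.2 ⟨tendsto_atTop_mono hk1 tendsto_id, ?_⟩, ?_⟩
  · exact tendsto_principal.2 (Eventually.of_forall fun m => even_of_natCast_eq hp hu (hk3 m))
  · rw [tendsto_comap_iff]
    refine Tendsto.prodMk_nhds (mx := fun m => (k m : ℤ_[p])) (my := fun m => (k m : ZMod (p - 1)))
      (tendsto_of_forall_pow_dvd_sub fun n => ?_) ?_
    · filter_upwards [eventually_ge_atTop n] with m hm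
      exact (pow_dvd_pow _ hm).trans (hk2 m)
    · simp only [hk3]
      exact tendsto_const_nhds

theorem tendsto_natCast_weightFilter (s : ℤ_[p]) (u : ZMod (p - 1)) :
    Tendsto (fun k : ℕ => (k : ℤ_[p])) (weightFilter p (s, u)) (𝓝 s) :=
  (continuous_fst.tendsto (s, u)).comp (tendsto_comap.mono_left inf_le_right)

theorem eventually_weightFilter (s : ℤ_[p]) (u : ZMod (p - 1)) :
    ∀ᶠ k : ℕ in weightFilter p (s, u), 2 ≤ k ∧ Even k ∧ (k : ZMod (p - 1)) = u := by
  have h1 : ∀ᶠ k : ℕ in weightFilter p (s, u), 2 ≤ k :=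
    (eventually_ge_atTop 2).filter_mono (inf_le_left.trans inf_le_left)
  have h2 : ∀ᶠ k : ℕ in weightFilter p (s, u), Even k :=
    (eventually_principal.2 fun _ h => h).filter_mono (inf_le_left.trans inf_le_right)
  have h3 : Tendsto (fun k : ℕ => (k : ZMod (p - 1))) (weightFilter p (s, u)) (𝓝 u) :=
    (continuous_snd.tendsto (s, u)).comp (tendsto_comap.mono_left inf_le_right)
  rw [nhds_discrete, tendsto_pure] at h3
  exact h1.and (h2.and h3)

theorem zetaStar_eq (hp : p ≠ 2) {s : ℤ_[p]} {u : ZMod (p - 1)} (hu : Even u) {z : ℚ_[p]}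
    (h : TendstoZetaStar p (s, u) z) : zetaStar p (1 - s, 1 - u) = z := by
  have := weightFilter_neBot hp s hu
  have e : (1 : PadicWeight p) - (1 - s, 1 - u) = (s, u) := by ext <;> simp
  rw [zetaStar, e]
  exact h.limUnder_eq

/-! ### The zeta function as a quotient of power series -/

/-- Write -B_k / k as (1 - c ^ k) B_k / k divided by c ^ k - 1. The interpolation error p ^ (-(k -
1)) tends to 0 because k also tends to infinity in the archimedean sense. -/
theorem tendstoZetaStar_div {c v : ℕ} {F W : ℤ_[p]⟦X⟧}
    (hF : ∀ j : ℕ, Even (j + 1) → j + 1 ≡ v [MOD p - 1] →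
      ‖(1 - (c : ℚ_[p]) ^ (j + 1)) * ((bernoulli (j + 1) : ℚ) : ℚ_[p]) / (j + 1 : ℕ) -
        (evalAt ((j + 1 : ℕ) : ℤ_[p]) F : ℚ_[p])‖ ≤ (p : ℝ) ^ (-j : ℤ))
    (hW : ∀ k : ℕ, k ≡ v [MOD p - 1] → evalAt (k : ℤ_[p]) W = (c : ℤ_[p]) ^ k)
    {s : ℤ_[p]} (hs : evalAt s W ≠ 1) :
    TendstoZetaStar p (s, (v : ZMod (p - 1)))
      ((evalAt s F : ℚ_[p]) / ((evalAt s W : ℚ_[p]) - 1)) := by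
  have hp1 : (1 : ℝ) < p := by exact_mod_cast (Fact.out : p.Prime).one_lt
  set l := weightFilter p (s, (v : ZMod (p - 1))) with hl
  have hev := eventually_weightFilter s (v : ZMod (p - 1))
  have hcoe : ∀ G : ℤ_[p]⟦X⟧, Tendsto (fun k : ℕ => (evalAt (k : ℤ_[p]) G : ℚ_[p])) l
      (𝓝 (evalAt s G : ℚ_[p])) := fun G =>
    ((continuous_subtype_val.comp (continuous_evalAt_left G)).tendsto s).comp
      (tendsto_natCast_weightFilter s _)
  have hden : Tendsto (fun k : ℕ => (c : ℚ_[p]) ^ k) l (𝓝 (evalAt s W : ℚ_[p])) := by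
    refine (hcoe W).congr' ?_
    filter_upwards [hev] with k hk
    rw [hW k ((ZMod.natCast_eq_natCast_iff _ _ _).1 hk.2.2)]
    simp
  have hdiff : Tendsto (fun k : ℕ => (1 - (c : ℚ_[p]) ^ k) * ((bernoulli k : ℚ) : ℚ_[p]) / k -
      (evalAt (k : ℤ_[p]) F : ℚ_[p])) l (𝓝 0) := by
    have hlim : Tendsto (fun k : ℕ => ((p : ℝ)⁻¹) ^ (k - 1)) l (𝓝 0) :=
      ((tendsto_pow_atTop_nhds_zero_of_lt_one (by positivity) (inv_lt_one_of_one_lt₀ hp1)).comp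
        (tendsto_sub_atTop_nat 1)).mono_left (inf_le_left.trans inf_le_left)
    refine squeeze_zero_norm' ?_ hlim
    filter_upwards [hev] with k hk
    obtain ⟨j, rfl⟩ := Nat.exists_eq_add_of_le' (show 1 ≤ k by omega)
    have := hF j hk.2.1 ((ZMod.natCast_eq_natCast_iff _ _ _).1 hk.2.2)
    rwa [zpow_neg, zpow_natCast, ← inv_pow] at this
  have hnum := hdiff.add (hcoe F)
  simp only [sub_add_cancel, zero_add] at hnum
  have hs' : (evalAt s W : ℚ_[p]) ≠ 1 := fun h => hs (Subtype.ext h)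
  refine (hnum.div (hden.sub_const 1) (sub_ne_zero.2 hs')).congr' ?_
  filter_upwards [hev, hden.eventually_ne hs'] with k hk hck
  have hk1 : k ≠ 1 := by omega
  have hck' := sub_ne_zero.2 hck
  have hk0 : (k : ℚ_[p]) ≠ 0 := by exact_mod_cast (show k ≠ 0 by omega)
  rw [zetaOneSub, ← bernoulli_eq_bernoulli'_of_ne_one hk1]
  push_cast
  simp only [Pi.div_apply]
  field_simp
  ring

/-- All values of F are congruent modulo p to its constant coefficient, so one unit value suffices.
-/
theorem isUnit_of_dvd_evalAt_sub {F : ℤ_[p]⟦X⟧} {s a : ℤ_[p]} (ha : IsUnit a)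
    (h : (p : ℤ_[p]) ∣ evalAt s F - a) : IsUnit F := by
  rw [PowerSeries.isUnit_iff_constantCoeff]
  have h1 : (p : ℤ_[p]) ∣ a - PowerSeries.constantCoeff F := by
    have := dvd_sub (dvd_evalAt_sub_constantCoeff s F) h
    rwa [sub_sub_sub_cancel_left] at this
  by_contra hn
  have h2 : PowerSeries.constantCoeff F ∈ IsLocalRing.maximalIdeal ℤ_[p] := hn
  have h3 : a - PowerSeries.constantCoeff F ∈ IsLocalRing.maximalIdeal ℤ_[p] := by
    rwa [PadicInt.maximalIdeal_eq_span_p, Ideal.mem_span_singleton]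
  exact (IsLocalRing.mem_maximalIdeal a).1 (by simpa using add_mem h3 h2) ha

theorem isUnit_evalAt {F : ℤ_[p]⟦X⟧} (hF : IsUnit F) (s : ℤ_[p]) : IsUnit (evalAt s F) :=
  hF.map (evalAt s)

theorem evalAt_inv_coe {F G : ℤ_[p]⟦X⟧} (h : F * G = 1) (s : ℤ_[p]) :
    (evalAt s G : ℚ_[p]) = (evalAt s F : ℚ_[p])⁻¹ := by
  refine eq_inv_of_mul_eq_one_right ?_
  rw [← PadicInt.coe_mul, ← map_mul, h, map_one, PadicInt.coe_one]

/-! ### The cases of nonzero and zero class modulo p - 1 -/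

theorem exists_coprime_pow_ne_one {v : ℕ} (hv : ¬ p - 1 ∣ v) :
    ∃ c : ℕ, c.Coprime p ∧ ¬ (p : ℤ_[p]) ∣ 1 - (c : ℤ_[p]) ^ v := by
  obtain ⟨g, hg⟩ := IsCyclic.exists_generator (α := (ZMod p)ˣ)
  have hord : orderOf g = p - 1 := by
    rw [orderOf_eq_card_of_forall_mem_zpowers hg, Nat.card_eq_fintype_card, ZMod.card_units]
  refine ⟨(g : ZMod p).val, ZMod.val_coe_unit_coprime g, fun h => hv ?_⟩
  rw [← hord]
  refine orderOf_dvd_of_pow_eq_one (Units.ext ?_)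
  have h' : PadicInt.toZMod (1 - (((g : ZMod p).val : ℕ) : ℤ_[p]) ^ v) = 0 := by
    rw [← RingHom.mem_ker, PadicInt.ker_toZMod, PadicInt.maximalIdeal_eq_span_p,
      Ideal.mem_span_singleton]
    exact h
  rw [map_sub, map_one, map_pow, map_natCast, ZMod.natCast_zmod_val, sub_eq_zero] at h'
  rw [Units.val_pow_eq_pow_val, ← h', Units.val_one]

/-- With c a primitive root modulo p, the series W - 1 has the unit value c ^ v - 1 at s = v, where
v represents u. So it is invertible and the quotient F / (W - 1) stays in Λ. -/
theorem exists_hasValue_zetaStar (hp : p ≠ 2) {u : ZMod (p - 1)} (hu : Even u) (hu0 : u ≠ 0) :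
    ∃ α : Lam p, ∀ s : ℤ_[p],
      TendstoZetaStar p (s, u) (zetaStar p (1 - s, 1 - u)) ∧
      HasValue (gammaPow s) α (zetaStar p (1 - s, 1 - u)) := by
  have : NeZero (p - 1) := ⟨by have := (Fact.out : p.Prime).two_le; omega⟩
  have huv : ((u.val : ℕ) : ZMod (p - 1)) = u := ZMod.natCast_zmod_val u
  have hv : ¬ p - 1 ∣ u.val := by
    rw [← ZMod.natCast_eq_zero_iff, huv]
    exact hu0
  obtain ⟨c, hc, hcv⟩ := exists_coprime_pow_ne_one hv
  obtain ⟨F, hF⟩ := exists_interpolation hp hc u.val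
  set W := weightSeries hp u.val (natUnit p c)
  have hW : ∀ k : ℕ, k ≡ u.val [MOD p - 1] → evalAt (k : ℤ_[p]) W = (c : ℤ_[p]) ^ k := by
    intro k hk
    rw [evalAt_weightSeries hp hk, coe_natUnit hc]
  have hunit : IsUnit (W - 1) := by
    refine isUnit_of_dvd_evalAt_sub (s := (u.val : ℤ_[p])) (a := (c : ℤ_[p]) ^ u.val - 1) ?_ ?_
    · by_contra hn
      have h1 : (c : ℤ_[p]) ^ u.val - 1 ∈ IsLocalRing.maximalIdeal ℤ_[p] := hn
      rw [PadicInt.maximalIdeal_eq_span_p, Ideal.mem_span_singleton, dvd_sub_comm] at h1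
      exact hcv h1
    · rw [map_sub, map_one, hW _ rfl, sub_self]
      exact dvd_zero _
  obtain ⟨G, hG⟩ := hunit.exists_right_inv
  refine ⟨lamEquiv hp (F * G), fun s => ?_⟩
  have hs : evalAt s W ≠ 1 := by
    have h := (isUnit_evalAt hunit s).ne_zero
    rwa [map_sub, map_one, sub_ne_zero] at h
  have ht := tendstoZetaStar_div hF hW hs
  rw [huv] at ht
  rw [zetaStar_eq hp hu ht]
  refine ⟨ht, ?_⟩
  have h := hasValue_lamEquiv hp s (F * G)
  rwa [map_mul (evalAt s), PadicInt.coe_mul, evalAt_inv_coe hG, map_sub, map_one, PadicInt.coe_sub,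
    PadicInt.coe_one, ← div_eq_mul_inv] at h

/-- Approximate s by natural numbers k: if (1 + p) ^ k ≡ 1 modulo p ^ (n + 1), then p ^ n ∣ k. -/
theorem gammaPow_gammaGen_ne_one (hp : p ≠ 2) {s : ℤ_[p]} (hs : s ≠ 0) :
    gammaPow s (gammaGen p) ≠ 1 := by
  intro h
  refine hs (eq_zero_of_forall_pow_dvd fun n => ?_)
  have h1 := (continuous_gammaPow (gammaGen p)).continuousAt.eventually
    (eventually_pow_dvd_sub (gammaPow s (gammaGen p)) (n + 1))
  obtain ⟨_, ⟨k, rfl⟩, hk1, hk2⟩ := ((mem_closure_iff_frequently.1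
    (PadicInt.denseRange_natCast s)).and_eventually (h1.and (eventually_pow_dvd_sub s n))).exists
  rw [h, gammaPow_natCast, coe_gammaGen, pow_dvd_one_add_pow_sub_one_iff hp] at hk1
  have hk3 : (p : ℤ_[p]) ^ n ∣ (k : ℤ_[p]) := by
    exact_mod_cast Nat.cast_dvd_cast (α := ℤ_[p]) hk1
  simpa using dvd_sub hk3 hk2

/-- For c = 1 + p the powers c ^ k are interpolated by 1 + X itself, so the denominator is X. -/
theorem exists_unit_zetaStar (hp : p ≠ 2) :
    ∃ F : ℤ_[p]⟦X⟧, IsUnit F ∧ ∀ s : ℤ_[p], s ≠ 0 →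
      TendstoZetaStar p (s, 0) ((evalAt s F : ℚ_[p]) / (evalAt s PowerSeries.X : ℚ_[p])) := by
  have hpp : p.Prime := Fact.out
  have hp1 : (1 : ℝ) < p := by exact_mod_cast hpp.one_lt
  have hc : (1 + p).Coprime p := by simp
  obtain ⟨F, hF⟩ := exists_interpolation hp hc 0
  refine ⟨F, ?_, fun s hs => ?_⟩
  -- The test weight 2 (p - 1) = j + 2 is visibly even and divisible by p - 1. Being at least 2, it
  -- makes the interpolation error smaller than 1, so F has there a value congruent to 1 modulo p.
  · obtain ⟨j, hj⟩ := Nat.exists_eq_add_of_le'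
      (show 2 ≤ 2 * (p - 1) by have := hpp.two_le; omega)
    have hj' : 2 * (p - 1) = (j + 1) + 1 := hj
    have he : Even (j + 1 + 1) := hj' ▸ even_two_mul _
    have hdvd : p - 1 ∣ j + 1 + 1 := hj' ▸ dvd_mul_left _ _
    have h1 := hF (j + 1) he ((Nat.modEq_zero_iff_dvd).2 hdvd)
    have h2 := norm_bernoulli_sub_one_le hp he (j + 1).succ_ne_zero hdvd
    refine isUnit_of_dvd_evalAt_sub (s := ((j + 1 + 1 : ℕ) : ℤ_[p])) isUnit_one ?_
    rw [← PadicInt.norm_lt_one_iff_dvd, PadicInt.norm_def, PadicInt.coe_sub, PadicInt.coe_one]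
    have h3 : (p : ℝ) ^ (-((j + 1 : ℕ) : ℤ)) < 1 := by
      rw [zpow_neg, zpow_natCast]
      exact inv_lt_one_of_one_lt₀ (one_lt_pow₀ hp1 j.succ_ne_zero)
    rw [norm_sub_rev] at h1
    have h4 := Padic.nonarchimedean _ _ |>.trans_lt (max_lt (h1.trans_lt h3) h2)
    rwa [sub_add_sub_cancel] at h4
  · have hX : ∀ t : ℤ_[p], evalAt t (1 + PowerSeries.X) = gammaPow t (gammaGen p) := by
      intro t
      rw [map_add, map_one, evalAt_X, add_sub_cancel]
    have ht := tendstoZetaStar_div (W := 1 + PowerSeries.X) hF (fun k _ => by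
      rw [hX, gammaPow_natCast, coe_gammaGen]
      push_cast
      rfl) (s := s) (by rw [hX]; exact gammaPow_gammaGen_ne_one hp hs)
    rwa [map_add, map_one, PadicInt.coe_add, PadicInt.coe_one, add_sub_cancel_left,
      Nat.cast_zero] at ht

end SerreZeta

end

theorem mainTheorem3 (p : ℕ) [Fact p.Prime] (hp : p ≠ 2) :
    (∀ u : ZMod (p - 1), Even u → u ≠ 0 →
      ∃ α : Lam p, ∀ s : ℤ_[p],
        TendstoZetaStar p (s, u) (zetaStar p (1 - s, 1 - u)) ∧
        HasValue (gammaPow s) α (zetaStar p (1 - s, 1 - u))) ∧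
    (∃ e : Lam p ≃ₐ[ℤ_[p]] ℤ_[p]⟦X⟧, e (groupLike (gammaGen p)) = 1 + PowerSeries.X ∧
      ∃ α : Lam p,
        (∀ s : ℤ_[p], s ≠ 0 →
          TendstoZetaStar p (s, 0) (zetaStar p (1 - s, 1)) ∧
          zetaStar p (1 - s, 1) ≠ 0 ∧
          HasValue (gammaPow s) α (zetaStar p (1 - s, 1))⁻¹) ∧
        ∃ g : ℤ_[p]⟦X⟧, IsUnit g ∧ e α = PowerSeries.X * g) := by
  refine ⟨fun u hu hu0 => SerreZeta.exists_hasValue_zetaStar hp hu hu0,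
    (SerreZeta.lamEquiv hp).symm, SerreZeta.lamEquiv_symm_gammaGen hp, ?_⟩
  obtain ⟨F, hF, hz⟩ := SerreZeta.exists_unit_zetaStar hp
  obtain ⟨G, hG⟩ := hF.exists_right_inv
  -- With G = F⁻¹, the series X G takes the values inverse to those of F / X.
  refine ⟨SerreZeta.lamEquiv hp (PowerSeries.X * G), fun s hs => ?_, G,
    IsUnit.of_mul_eq_one_right F hG, AlgEquiv.symm_apply_apply _ _⟩
  have ht := hz s hs
  have he := SerreZeta.zetaStar_eq hp Even.zero ht
  rw [sub_zero] at he
  rw [he]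
  refine ⟨ht, div_ne_zero ?_ ?_, ?_⟩
  · exact fun h => (SerreZeta.isUnit_evalAt hF s).ne_zero (Subtype.ext h)
  · intro h
    have h0 : SerreZeta.evalAt s PowerSeries.X = 0 := Subtype.ext h
    rw [SerreZeta.evalAt_X, sub_eq_zero] at h0
    exact SerreZeta.gammaPow_gammaGen_ne_one hp hs h0
  · have h := SerreZeta.hasValue_lamEquiv hp s (PowerSeries.X * G)
    rwa [map_mul (SerreZeta.evalAt s), PadicInt.coe_mul, SerreZeta.evalAt_inv_coe hG,
      ← div_eq_mul_inv, ← inv_div] at h
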